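/- \textbf{Setting.} Let $0<a<b$, let $\sigma_1,\sigma_2>0$, $\varrho\in(-1,1)$, put $$\Sigma=\begin{pmatrix}\sigma_1^2&\sigma_1\sigma_2\varrho\\ \sigma_1\sigma_2\varrho&\sigma_2^2\end{pmatrix},$$ and let $\Sigma^{1/2}$ be its symmetric positive semidefinite square root. Let $\varepsilon=(\varepsilon_1,\varepsilon_2)^\top$ be a pair of independent standard Brownian motions on a probability space. Let $F:[a,b]\to\mathbb R^{p\times 2}$ be continuously differentiable with derivative $\dot F$. For $\theta\in\mathbb R^p$ consider the model $$Y(t)=F(t)^\top\theta+\Sigma^{1/2}\varepsilon(t),\qquad t\in[a,b],$$ and write $\mathbb E_\theta$, $\mathrm{Cov}_\theta$ for expectation and covariance under the parameter $\theta$. Put $$M_0=\int_a^b\dot F(t)\Sigma^{-1}\dot F(t)^\top dt,\qquad M=M_0+\tfrac1a F(a)\Sigma^{-1}F(a)^\top,$$ and assume that $M$ is nonsingular. Let $$\hat\theta_{\rm BLUE}=M^{-1}\Big(\int_a^b\dot F(t)\Sigma^{-1}\,dY(t)+\tfrac1aF(a)\Sigma^{-1}Y(a)\Big),$$ where the stochastic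 integral is the $L^2$-limit of the left-point Riemann sums as the mesh of the partition of $[a,b]$ tends to $0$. An estimator is called linear if it is, under every $\theta$, the $L^2$-limit of one and the same (not depending on $\theta$) sequence of finite sums $\sum_i C_iY(s_i)$ with $s_i\in[a,b]$ and $C_i\in\mathbb R^{p\times2}$. It is called unbiased if its expectation under every $\theta$ is $\theta$. Matrices are compared in the Loewner order ($A\le A'$ iff $A'-A$ is symmetric positive semidefinite). Fix $n\ge2$ and design points $a=t_1<t_2<\dots<t_n=b$. For weights $\Phi=(\Phi_2,\dots,\Phi_n)$ with $\Phi_i\in\mathbb R^{p\times2}$ let $$\hat\theta_n(\Phi)=M^{-1}\Big(\sum_{i=2}^n\Phi_i\Sigma^{-1}\big(Y(t_i)-Y(t_{i-1})\big)+\tfrac1aF(a)\Sigma^{-1}Y(a)\Big).$$ \textbf{Theorem.} Assume that $$B=\sum_{i=2}^n\frac{(F(t_i)-F(t_{i-1}))\,\Sigma^{-1}\,(F(t_i)-F(t_{i-1}))^\top}{t_i-t_{i-1}}$$ is nonsingular and let $$\Phi_i^*=M_0B^{-1}\,\frac{F(t_i)-F(t_{i-1})}{t_i-t_{i-1}},\qquad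 i=2,\dots,n.$$ Then: \begin{enumerate} \item[(0)] $\hat\theta_{\rm BLUE}$ is a best linear unbiased estimator of $\theta$ in the continuous time model: it is linear and unbiased, and for every linear unbiased estimator $T$ and every $\theta$ one has $\mathrm{Cov}_\theta(\hat\theta_{\rm BLUE})\le\mathrm{Cov}_\theta(T)$. \item[(1)] $\hat\theta_n(\Phi^*)$ is unbiased, and for all weights $\Phi=(\Phi_2,\dots,\Phi_n)$ such that $\hat\theta_n(\Phi)$ is unbiased and for all $\theta\in\mathbb R^p$ $$\mathbb E_\theta\big[(\hat\theta_{\rm BLUE}-\hat\theta_n(\Phi^*))(\hat\theta_{\rm BLUE}-\hat\theta_n(\Phi^*))^\top\big]\le\mathbb E_\theta\big[(\hat\theta_{\rm BLUE}-\hat\theta_n(\Phi))(\hat\theta_{\rm BLUE}-\hat\theta_n(\Phi))^\top\big].$$ \item[(2)] For every $\theta\in\mathbb R^p$, $$\mathrm{Cov}_\theta(\hat\theta_n(\Phi^*))=M^{-1}\Big\{M_0B^{-1}M_0+\tfrac1aF(a)\Sigma^{-1}F(a)^\top\Big\}M^{-1}.$$ \end{enumerate} -/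

import Mathlib

open MeasureTheory ProbabilityTheory Set
open scoped Matrix NNReal ENNReal MatrixOrder

noncomputable section

namespace CurveDesign

/-- The covariance matrix `Σ` of the two groups. -/
def sigmaMat (σ₁ σ₂ ρ : ℝ) : Matrix (Fin 2) (Fin 2) ℝ :=
  !![σ₁ ^ 2, σ₁ * σ₂ * ρ; σ₁ * σ₂ * ρ, σ₂ ^ 2]

section Matrices

variable {p : ℕ}

/-- The matrix `F` of regression functions is continuously differentiable on `[a, b]`
(one-sided derivatives at the end points). -/
def IsC1 (F : ℝ → Matrix (Fin p) (Fin 2) ℝ) (a b : ℝ) : Prop :=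
  ∀ k l, ContDiffOn ℝ 1 (fun t => F t k l) (Icc a b)

/-- The entrywise derivative of `F` on `[a, b]`. -/
def dotF (F : ℝ → Matrix (Fin p) (Fin 2) ℝ) (a b t : ℝ) : Matrix (Fin p) (Fin 2) ℝ :=
  Matrix.of fun k l => derivWithin (fun s => F s k l) (Icc a b) t

/-- `M₀ = ∫ₐᵇ Ḟ(t) S⁻¹ Ḟ(t)ᵀ dt`, entry by entry. -/
def matM₀ (F : ℝ → Matrix (Fin p) (Fin 2) ℝ) (S : Matrix (Fin 2) (Fin 2) ℝ) (a b : ℝ) :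
    Matrix (Fin p) (Fin p) ℝ :=
  Matrix.of fun k l => ∫ t in a..b, (dotF F a b t * S⁻¹ * (dotF F a b t)ᵀ) k l

/-- `M = M₀ + (1/a) F(a) S⁻¹ F(a)ᵀ`. -/
def matM (F : ℝ → Matrix (Fin p) (Fin 2) ℝ) (S : Matrix (Fin 2) (Fin 2) ℝ) (a b : ℝ) :
    Matrix (Fin p) (Fin p) ℝ :=
  matM₀ F S a b + (1 / a) • (F a * S⁻¹ * (F a)ᵀ)

/-- `B = ∑ᵢ (F(tᵢ) - F(tᵢ₋₁)) S⁻¹ (F(tᵢ) - F(tᵢ₋₁))ᵀ / (tᵢ - tᵢ₋₁)` for the `m + 1` design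
points `t 0, …, t m`. -/
def matB (F : ℝ → Matrix (Fin p) (Fin 2) ℝ) (S : Matrix (Fin 2) (Fin 2) ℝ) {m : ℕ}
    (t : Fin (m + 1) → ℝ) : Matrix (Fin p) (Fin p) ℝ :=
  ∑ i : Fin m, (1 / (t i.succ - t i.castSucc)) •
    ((F (t i.succ) - F (t i.castSucc)) * S⁻¹ * (F (t i.succ) - F (t i.castSucc))ᵀ)

end Matrices

section Processes

variable {Ω : Type*} [MeasurableSpace Ω] {p : ℕ}

/-- `ε` is a pair of independent standard Brownian motions. -/
structure IsBrownianPair (ε : Fin 2 → ℝ≥0 → Ω → ℝ) (P : Measure Ω) : Prop where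
  brownian : ∀ j, IsBrownianReal (ε j) P
  indep : IndepFun (fun ω t => ε 0 t ω) (fun ω t => ε 1 t ω) P

/-- The observed process `Y(t) = F(t)ᵀ θ + S^{1/2} ε(t)` under the parameter `θ`
(only times `t ≥ 0` are meaningful). -/
def obs (F : ℝ → Matrix (Fin p) (Fin 2) ℝ) (S : Matrix (Fin 2) (Fin 2) ℝ)
    (ε : Fin 2 → ℝ≥0 → Ω → ℝ) (θ : Fin p → ℝ) (t : ℝ) (ω : Ω) : Fin 2 → ℝ :=
  (F t)ᵀ *ᵥ θ + CFC.sqrt S *ᵥ (fun j => ε j t.toNNReal ω)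

/-- The left-point sum `∑ᵢ g(sᵢ) (Z(sᵢ₊₁) - Z(sᵢ))` along a partition `s 0 ≤ … ≤ s N`. -/
def leftSum (g : ℝ → ℝ) (Z : ℝ → Ω → ℝ) {N : ℕ} (s : Fin (N + 1) → ℝ) (ω : Ω) : ℝ :=
  ∑ i : Fin N, g (s i.castSucc) * (Z (s i.succ) ω - Z (s i.castSucc) ω)

/-- `I` is the stochastic integral `∫ₐᵇ g dZ` of the deterministic integrand `g`:
the limit in `L²(P)` of the left-point sums as the mesh of the partition tends to zero. -/
def IsStochIntegral (g : ℝ → ℝ) (Z : ℝ → Ω → ℝ) (a b : ℝ) (P : Measure Ω) (I : Ω → ℝ) : Prop :=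
  MemLp I 2 P ∧
  ∀ η : ℝ≥0∞, 0 < η → ∃ δ : ℝ, 0 < δ ∧ ∀ (N : ℕ) (s : Fin (N + 1) → ℝ),
    Monotone s → s 0 = a → s (Fin.last N) = b →
    (∀ i : Fin N, s i.succ - s i.castSucc ≤ δ) →
    eLpNorm (fun ω => leftSum g Z s ω - I ω) 2 P ≤ η

open Classical in
/-- The stochastic integral `∫ₐᵇ g dZ` (a version of the `L²`-limit; zero if there is none). -/
def stochIntegral (g : ℝ → ℝ) (Z : ℝ → Ω → ℝ) (a b : ℝ) (P : Measure Ω) : Ω → ℝ :=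
  if h : ∃ I, IsStochIntegral g Z a b P I then h.choose else 0

/-- The vector stochastic integral `∫ₐᵇ G dY` for a `p × 2` matrix-valued deterministic `G`. -/
def stochIntegralVec (G : ℝ → Matrix (Fin p) (Fin 2) ℝ) (Y : ℝ → Ω → Fin 2 → ℝ) (a b : ℝ)
    (P : Measure Ω) (ω : Ω) : Fin p → ℝ :=
  fun k => ∑ l, stochIntegral (fun t => G t k l) (fun t ω => Y t ω l) a b P ω

/-- The estimator `M⁻¹ (∫ₐᵇ Ḟ(t) S⁻¹ dY(t) + (1/a) F(a) S⁻¹ Y(a))` in the continuous time model,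
under the parameter `θ`. -/
def thetaBLUE (F : ℝ → Matrix (Fin p) (Fin 2) ℝ) (S : Matrix (Fin 2) (Fin 2) ℝ) (a b : ℝ)
    (ε : Fin 2 → ℝ≥0 → Ω → ℝ) (P : Measure Ω) (θ : Fin p → ℝ) (ω : Ω) : Fin p → ℝ :=
  (matM F S a b)⁻¹ *ᵥ
    (stochIntegralVec (fun t => dotF F a b t * S⁻¹) (obs F S ε θ) a b P ω
      + ((1 / a) • (F a * S⁻¹)) *ᵥ obs F S ε θ a ω)

/-- The discrete estimator
`M⁻¹ (∑ᵢ Φᵢ S⁻¹ (Y(tᵢ) - Y(tᵢ₋₁)) + (1/a) F(a) S⁻¹ Y(a))` with `p × 2` weights `Φᵢ`,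
under the parameter `θ`. -/
def thetaDiscrete (F : ℝ → Matrix (Fin p) (Fin 2) ℝ) (S : Matrix (Fin 2) (Fin 2) ℝ) (a b : ℝ)
    (ε : Fin 2 → ℝ≥0 → Ω → ℝ) {m : ℕ} (t : Fin (m + 1) → ℝ)
    (Φ : Fin m → Matrix (Fin p) (Fin 2) ℝ) (θ : Fin p → ℝ) (ω : Ω) : Fin p → ℝ :=
  (matM F S a b)⁻¹ *ᵥ
    (∑ i : Fin m, (Φ i * S⁻¹) *ᵥ (obs F S ε θ (t i.succ) ω - obs F S ε θ (t i.castSucc) ω)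
      + ((1 / a) • (F a * S⁻¹)) *ᵥ obs F S ε θ a ω)

/-- The matrix `E[(X - Z)(X - Z)ᵀ]`. -/
def mseMatrix (X Z : Ω → Fin p → ℝ) (P : Measure Ω) : Matrix (Fin p) (Fin p) ℝ :=
  Matrix.of fun k l => ∫ ω, (X ω k - Z ω k) * (X ω l - Z ω l) ∂P

/-- The covariance matrix of the random vector `X`. -/
def covMatrix (X : Ω → Fin p → ℝ) (P : Measure Ω) : Matrix (Fin p) (Fin p) ℝ :=
  Matrix.of fun k l => cov[fun ω => X ω k, fun ω => X ω l; P]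

/-- The estimator `T` (`T θ` is its value under the parameter `θ`) is unbiased. -/
def IsUnbiased (T : (Fin p → ℝ) → Ω → Fin p → ℝ) (P : Measure Ω) : Prop :=
  ∀ θ k, Integrable (fun ω => T θ ω k) P ∧ ∫ ω, T θ ω k ∂P = θ k

/-- `T` is a linear estimator based on `{Y(t) | t ∈ [a, b]}`: square integrable and, under every
`θ`, the `L²`-limit of one and the same sequence of finite linear combinations of observations. -/
def IsLinearEstimator (F : ℝ → Matrix (Fin p) (Fin 2) ℝ) (S : Matrix (Fin 2) (Fin 2) ℝ)
    (a b : ℝ) (ε : Fin 2 → ℝ≥0 → Ω → ℝ) (P : Measure Ω)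
    (T : (Fin p → ℝ) → Ω → Fin p → ℝ) : Prop :=
  (∀ θ k, MemLp (fun ω => T θ ω k) 2 P) ∧
  ∃ (N : ℕ → ℕ) (s : (n : ℕ) → Fin (N n) → ℝ)
    (C : (n : ℕ) → Fin (N n) → Matrix (Fin p) (Fin 2) ℝ),
    (∀ n i, s n i ∈ Icc a b) ∧
    ∀ θ k, Filter.Tendsto
      (fun n => eLpNorm (fun ω => (∑ i, C n i *ᵥ obs F S ε θ (s n i) ω) k - T θ ω k) 2 P)
      Filter.atTop (nhds 0)

/-- `T` is a best linear unbiased estimator in the continuous time model: its covariance matrix is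
minimal in the Loewner order, for every `θ`, among all linear unbiased estimators. -/
structure IsBLUE (F : ℝ → Matrix (Fin p) (Fin 2) ℝ) (S : Matrix (Fin 2) (Fin 2) ℝ)
    (a b : ℝ) (ε : Fin 2 → ℝ≥0 → Ω → ℝ) (P : Measure Ω)
    (T : (Fin p → ℝ) → Ω → Fin p → ℝ) : Prop where
  linear : IsLinearEstimator F S a b ε P T
  unbiased : IsUnbiased T P
  best : ∀ T', IsLinearEstimator F S a b ε P T' → IsUnbiased T' P →
    ∀ θ, (covMatrix (T' θ) P - covMatrix (T θ) P).PosSemidef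

end Processes

end CurveDesign

end

noncomputable section

namespace CurveDesign

open Filter Topology
open scoped RealInnerProductSpace

/-! The theorem is Hilbert space geometry in `L²(P)`. An estimator is a constant vector plus a
centred error, covariances are matrices of inner products (`crossGram`), and only second moments of
the noise `n = S^{1/2} ε` enter. Up to the factor `S`, its covariance is that of the indicators of
`(0, t]` in `L²(ℝ)`, so stochastic integrals of continuous functions exist because step functions
converge there (`tendsto_leftSumOf_cutoff`, `exists_tendsto_leftSumOf`).

The score `ν = ∫ Ḟ S⁻¹ dn + (1/a) F(a) S⁻¹ n(a)` has the reproducing property `Cov(ν, n(t)) = F(t)`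
(`IsNoise.crossGram_score`), whence `Cov(ν) = M`. A finite sum `∑ Cᵢ Y(sᵢ)` has mean `(∑ Cᵢ F(sᵢ)ᵀ)
θ`, and that same matrix is the covariance of its noise with `ν`. In the limit, the error `u` of a
linear unbiased estimator satisfies `Cov(u, ν) = 1` (`IsLinearEstimator.exists_isRep`). The error of
the continuous time estimator is `β = M⁻¹ ν`, so `u - β` is orthogonal to `β` and `Cov(u) = Cov(β) +
Cov(u - β)` (`crossGram_sub_act_inv`). This gives optimality of the estimator, and also turns the
mean square distance in (1) into `Cov(u) - Cov(β)`, so that only the covariance of the discrete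
estimator has to be minimised.

A discrete estimator is unbiased exactly when `∑ Φᵢ S⁻¹ ΔFᵢᵀ = M₀`. Increments of `n` are
orthogonal, so up to a fixed term the covariance of the brackets with weights `Φ` and `Ψ` is `∑ Δtᵢ
Φᵢ S⁻¹ Ψᵢᵀ`. For `Ψ = Φ*`, proportional to `ΔFᵢ / Δtᵢ`, this depends on `Φ` only through the
constraint (`weightMat_of_proportional`). A second use of Pythagoras (`crossGram_sub_sub`) gives
(1), and the value at `Φ = Φ*` is (2). -/

/-! ### Partitions of an interval and the limit of vanishing mesh. -/

/-- A finite sequence of time points, of unspecified length. -/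
abbrev Points : Type := Σ N : ℕ, Fin (N + 1) → ℝ

/-- The partitions of `[a, b]` of mesh at most `δ`. -/
def finePartitions (a b δ : ℝ) : Set Points :=
  {s | Monotone s.2 ∧ s.2 0 = a ∧ s.2 (Fin.last s.1) = b ∧
    ∀ i : Fin s.1, s.2 i.succ - s.2 i.castSucc ≤ δ}

/-- The filter of partitions of `[a, b]` whose mesh tends to zero. -/
def meshFilter (a b : ℝ) : Filter Points :=
  ⨅ δ ∈ Ioi (0 : ℝ), 𝓟 (finePartitions a b δ)

lemma finePartitions_mono (a b : ℝ) : Monotone (finePartitions a b) :=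
  fun _ _ h _ hs => ⟨hs.1, hs.2.1, hs.2.2.1, fun i => (hs.2.2.2 i).trans h⟩

lemma hasBasis_meshFilter (a b : ℝ) :
    (meshFilter a b).HasBasis (fun δ : ℝ => 0 < δ) (finePartitions a b) := by
  refine hasBasis_biInf_principal ?_ ⟨1, mem_Ioi.2 one_pos⟩
  intro x hx y hy
  exact ⟨min x y, mem_Ioi.2 (lt_min hx hy), finePartitions_mono a b (min_le_left _ _),
    finePartitions_mono a b (min_le_right _ _)⟩

/-- The equidistant partition of `[a, b]` into `n + 1` pieces. -/
def uniformPoints (a b : ℝ) (n : ℕ) : Points :=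
  ⟨n + 1, fun i => a + (i : ℕ) * ((b - a) / (n + 1))⟩

lemma uniformPoints_mem_finePartitions {a b : ℝ} (hab : a ≤ b) (n : ℕ) :
    uniformPoints a b n ∈ finePartitions a b ((b - a) / (n + 1)) := by
  have hn0 : (0 : ℝ) < n + 1 := by positivity
  refine ⟨fun i j hij => ?_, ?_, ?_, fun i => ?_⟩
  · have : ((i : ℕ) : ℝ) ≤ (j : ℕ) := by exact_mod_cast hij
    have h0 : 0 ≤ (b - a) / ((n : ℝ) + 1) := div_nonneg (by linarith) hn0.le
    simp only [uniformPoints]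
    gcongr
  · simp [uniformPoints]
  · simp only [uniformPoints, Fin.val_last]
    push_cast
    field_simp
    ring
  · simp only [uniformPoints] at i ⊢
    rw [Fin.val_succ, Fin.val_castSucc]
    push_cast
    linarith

/-- Serves twice: limits along the mesh filter become unique, and a mesh limit becomes the limit of
a sequence, as the definition of a linear estimator demands. -/
lemma tendsto_uniformPoints {a b : ℝ} (hab : a ≤ b) :
    Tendsto (uniformPoints a b) atTop (meshFilter a b) := by
  rw [(hasBasis_meshFilter a b).tendsto_right_iff]
  intro δ hδ
  have h : Tendsto (fun n : ℕ => (b - a) / ((n : ℝ) + 1)) atTop (𝓝 0) :=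
    tendsto_const_div_atTop_nhds_zero_nat (b - a) |>.comp (tendsto_add_atTop_nat 1) |>.congr
      fun n => by simp
  filter_upwards [h.eventually (gt_mem_nhds hδ)] with n hn
  exact finePartitions_mono a b hn.le (uniformPoints_mem_finePartitions hab n)

lemma neBot_meshFilter {a b : ℝ} (hab : a ≤ b) : (meshFilter a b).NeBot :=
  (tendsto_uniformPoints hab).neBot

lemma mem_Icc_of_mem_finePartitions {a b δ : ℝ} {s : Points} (hs : s ∈ finePartitions a b δ)
    (i : Fin (s.1 + 1)) : s.2 i ∈ Icc a b :=
  ⟨hs.2.1 ▸ hs.1 (Fin.zero_le i), hs.2.2.1 ▸ hs.1 (Fin.le_last i)⟩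

/-! ### Left-point sums with values in a vector space. -/

section LeftSums

variable {E E' : Type*} [AddCommGroup E] [Module ℝ E] [AddCommGroup E'] [Module ℝ E']

/-- The left-point sum of the real function `g` against the vector-valued function `Z`. -/
def leftSumOf (g : ℝ → ℝ) (Z : ℝ → E) (s : Points) : E :=
  ∑ i : Fin s.1, g (s.2 i.castSucc) • (Z (s.2 i.succ) - Z (s.2 i.castSucc))

lemma map_leftSumOf (φ : E →ₗ[ℝ] E') (g : ℝ → ℝ) (Z : ℝ → E) (s : Points) :
    φ (leftSumOf g Z s) = leftSumOf g (fun t => φ (Z t)) s := by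
  simp [leftSumOf]

lemma leftSumOf_add (g : ℝ → ℝ) (Z Z' : ℝ → E) (s : Points) :
    leftSumOf g (fun t => Z t + Z' t) s = leftSumOf g Z s + leftSumOf g Z' s := by
  simp only [leftSumOf, ← Finset.sum_add_distrib, ← smul_add, add_sub_add_comm]

lemma leftSumOf_smul_const (g f : ℝ → ℝ) (x : E) (s : Points) :
    leftSumOf g (fun t => f t • x) s = leftSumOf g f s • x := by
  simp only [leftSumOf, Finset.sum_smul, ← sub_smul, smul_eq_mul, mul_smul]

lemma leftSumOf_const_mul (g f : ℝ → ℝ) (c : ℝ) (s : Points) :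
    leftSumOf g (fun t => c * f t) s = c * leftSumOf g f s := by
  simp only [leftSumOf, Finset.mul_sum, smul_eq_mul]
  exact Finset.sum_congr rfl fun i _ => by ring

/-- Only increments of the integrator between points of `[a, b]` enter the sum, so an additive
constant drops out. -/
lemma leftSumOf_congr {a b δ : ℝ} {g : ℝ → ℝ} {Z Z' : ℝ → E} (c : E)
    (h : ∀ t ∈ Icc a b, Z t = Z' t + c) {s : Points} (hs : s ∈ finePartitions a b δ) :
    leftSumOf g Z s = leftSumOf g Z' s := by
  refine Finset.sum_congr rfl fun i _ => ?_
  rw [h _ (mem_Icc_of_mem_finePartitions hs _), h _ (mem_Icc_of_mem_finePartitions hs _),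
    add_sub_add_right_eq_sub]

end LeftSums

/-! ### Transfer of convergence through covariance functions. -/

section InnerProducts

variable {H K : Type*} [NormedAddCommGroup H] [InnerProductSpace ℝ H]
  [NormedAddCommGroup K] [InnerProductSpace ℝ K]

lemma inner_leftSumOf (g : ℝ → ℝ) (Z : ℝ → H) (s : Points) (y : H) :
    ⟪y, leftSumOf g Z s⟫ = leftSumOf g (fun t => ⟪y, Z t⟫) s :=
  map_leftSumOf (innerₗ H y) g Z s

lemma inner_leftSumOf_leftSumOf {Z : ℝ → H} {Z' : ℝ → K} {c : ℝ}
    (h : ∀ s t, ⟪Z s, Z t⟫ = c * ⟪Z' s, Z' t⟫) (g : ℝ → ℝ) (s s' : Points) :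
    ⟪leftSumOf g Z s, leftSumOf g Z s'⟫ = c * ⟪leftSumOf g Z' s, leftSumOf g Z' s'⟫ := by
  rw [inner_leftSumOf, inner_leftSumOf, ← leftSumOf_const_mul]
  congr 1
  ext t
  rw [real_inner_comm, inner_leftSumOf, real_inner_comm, inner_leftSumOf, ← leftSumOf_const_mul]
  simp only [h]

/-- Left-point sums converge as soon as they do so for an integrator with a proportional
covariance function. -/
lemma exists_tendsto_leftSumOf [CompleteSpace H] {Z : ℝ → H} {Z' : ℝ → K} {c : ℝ}
    (h : ∀ s t, ⟪Z s, Z t⟫ = c * ⟪Z' s, Z' t⟫) {g : ℝ → ℝ} {l : Filter Points} [l.NeBot] {y : K}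
    (hy : Tendsto (leftSumOf g Z') l (𝓝 y)) : ∃ x, Tendsto (leftSumOf g Z) l (𝓝 x) := by
  rw [← cauchy_map_iff_exists_tendsto, cauchy_map_iff']
  have hc := cauchy_map_iff'.1 hy.cauchy_map
  rw [Metric.uniformity_eq_comap_nhds_zero, tendsto_comap_iff] at hc ⊢
  -- Squared distances between left-point sums are combinations of covariances, so the two
  -- integrators differ by the factor `c` and the Cauchy property carries over.
  have key : ∀ q : Points × Points, dist (leftSumOf g Z q.1) (leftSumOf g Z q.2) =
      √(c * dist (leftSumOf g Z' q.1) (leftSumOf g Z' q.2) ^ 2) := fun q => by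
    have e : dist (leftSumOf g Z q.1) (leftSumOf g Z q.2) ^ 2 =
        c * dist (leftSumOf g Z' q.1) (leftSumOf g Z' q.2) ^ 2 := by
      simp only [dist_eq_norm, ← real_inner_self_eq_norm_sq, inner_sub_left, inner_sub_right,
        inner_leftSumOf_leftSumOf h]
      ring
    rw [← e, Real.sqrt_sq dist_nonneg]
  have h2 := ((hc.pow 2).const_mul c).sqrt
  simp only [ne_eq, OfNat.ofNat_ne_zero, not_false_eq_true, zero_pow, mul_zero, Real.sqrt_zero]
    at h2
  exact h2.congr fun q => (key q).symm

end InnerProducts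

/-! ### The model of Brownian motion by indicator functions in `L²(ℝ)`. -/

/-- The indicator function of `(0, t]` as an element of `L²(ℝ)`. -/
def cutoff (t : ℝ) : Lp ℝ 2 (volume : Measure ℝ) :=
  indicatorConstLp 2 (measurableSet_Ioc : MeasurableSet (Ioc 0 t)) measure_Ioc_lt_top.ne 1

lemma inner_cutoff (t : ℝ) (f : Lp ℝ 2 (volume : Measure ℝ)) :
    ⟪cutoff t, f⟫ = ∫ x in Ioc 0 t, f x :=
  L2.inner_indicatorConstLp_one _ _ f

/-- The intervals overlap in `(0, min s t]`, which gives the Brownian covariance. Truncation at zero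
matches the clock `t.toNNReal` of `obs`, so the comparison holds at all real times. -/
lemma inner_cutoff_cutoff (s t : ℝ) :
    ⟪cutoff s, cutoff t⟫ = min (s.toNNReal : ℝ) t.toNNReal := by
  rw [cutoff, cutoff, L2.real_inner_indicatorConstLp_one_indicatorConstLp_one _ _
    measure_Ioc_lt_top.ne measure_Ioc_lt_top.ne, Ioc_inter_Ioc, Real.volume_real_Ioc]
  simp only [max_self, sub_zero, Real.coe_toNNReal']
  exact max_min_distrib_right _ _ _

lemma memLp_indicator_of_continuousOn {a b : ℝ} {g : ℝ → ℝ} (hg : ContinuousOn g (Icc a b)) :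
    MemLp ((Ioc a b).indicator g) 2 volume := by
  rw [memLp_indicator_iff_restrict measurableSet_Ioc]
  obtain ⟨C, hC⟩ := isCompact_Icc.exists_bound_of_continuousOn hg
  refine MemLp.of_bound ((hg.mono Ioc_subset_Icc_self).aestronglyMeasurable measurableSet_Ioc) C ?_
  filter_upwards [ae_restrict_mem measurableSet_Ioc] with x hx
  exact hC x (Ioc_subset_Icc_self hx)

lemma inner_cutoff_toLp {a b t : ℝ} (ha : 0 ≤ a) (ht : t ∈ Icc a b) {g : ℝ → ℝ}
    (hg : ContinuousOn g (Icc a b)) :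
    ⟪cutoff t, (memLp_indicator_of_continuousOn hg).toLp _⟫ = ∫ x in a..t, g x := by
  rw [inner_cutoff, setIntegral_congr_ae measurableSet_Ioc
    ((memLp_indicator_of_continuousOn hg).coeFn_toLp.mono fun x hx _ => hx),
    setIntegral_indicator measurableSet_Ioc, Ioc_inter_Ioc, max_eq_right ha, min_eq_left ht.2,
    intervalIntegral.integral_of_le ht.1]

lemma coeFn_sum_smul {Ω : Type*} [MeasurableSpace Ω] {P : Measure Ω} {ι : Type*} [Fintype ι]
    (c : ι → ℝ) {z : ι → Lp ℝ 2 P} {Z : ι → Ω → ℝ} (h : ∀ i, z i =ᵐ[P] Z i) :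
    ⇑(∑ i, c i • z i) =ᵐ[P] fun ω => ∑ i, c i * Z i ω := by
  filter_upwards [Lp.coeFn_finsetSum Finset.univ fun i => c i • z i,
    ae_all_iff.2 h, ae_all_iff.2 fun i => Lp.coeFn_smul (c i) (z i)] with ω h1 h2 h3
  rw [h1, Finset.sum_apply]
  exact Finset.sum_congr rfl fun i _ => by rw [h3, Pi.smul_apply, h2, smul_eq_mul]

lemma coeFn_leftSumOf {Ω : Type*} [MeasurableSpace Ω] {P : Measure Ω} (g : ℝ → ℝ)
    {z : ℝ → Lp ℝ 2 P} {Z : ℝ → Ω → ℝ} (h : ∀ t, z t =ᵐ[P] Z t) (s : Points) :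
    ⇑(leftSumOf g z s) =ᵐ[P] fun ω => leftSumOf g (fun t => Z t ω) s :=
  coeFn_sum_smul _ fun _ => (Lp.coeFn_sub _ _).trans ((h _).sub (h _))

/-- A point of `(a, b]` lies in exactly one cell `(sᵢ, sᵢ₊₁]`, where the sum takes the value of `g`
at the left end, at distance at most `δ`. -/
lemma abs_leftSumOf_indicator_sub_le {a b δ η : ℝ} (ha : 0 ≤ a) {g : ℝ → ℝ}
    (hg : ∀ x ∈ Icc a b, ∀ y ∈ Icc a b, |x - y| ≤ δ → |g x - g y| ≤ η)
    {s : Points} (hs : s ∈ finePartitions a b δ) (x : ℝ) :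
    |leftSumOf g (fun t => (Ioc 0 t).indicator (fun _ => (1 : ℝ)) x) s - (Ioc a b).indicator g x| ≤
      (Ioc a b).indicator (fun _ => η) x := by
  have hs0 : ∀ i, 0 ≤ s.2 i := fun i => ha.trans (mem_Icc_of_mem_finePartitions hs i).1
  set u : ℝ → ℝ := fun t => (Ioc 0 t).indicator (fun _ => (1 : ℝ)) x with hu
  have hinc : ∀ v w, 0 ≤ v → v ≤ w → u w - u v = (Ioc v w).indicator (fun _ => (1 : ℝ)) x := by
    intro v w hv hvw
    simp only [hu, indicator_apply, mem_Ioc]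
    split_ifs <;> grind
  -- The cells tile `(a, b]`. Telescoping comes from splitting the sum over all partition points
  -- once at the first and once at the last point.
  have htot : ∑ i : Fin s.1, (u (s.2 i.succ) - u (s.2 i.castSucc)) =
      (Ioc a b).indicator (fun _ => (1 : ℝ)) x := by
    have hab : a ≤ b := by
      have := mem_Icc_of_mem_finePartitions hs 0
      exact this.1.trans this.2
    rw [← hinc a b ha hab, Finset.sum_sub_distrib]
    have h1 := Fin.sum_univ_succ fun i => u (s.2 i)
    have h2 := Fin.sum_univ_castSucc fun i => u (s.2 i)
    rw [hs.2.1] at h1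
    rw [hs.2.2.1] at h2
    linarith
  have e1 : (Ioc a b).indicator g x =
      ∑ i : Fin s.1, g x * (u (s.2 i.succ) - u (s.2 i.castSucc)) := by
    rw [← Finset.mul_sum, htot]; simp [indicator_apply]
  have e2 : (Ioc a b).indicator (fun _ => η) x =
      ∑ i : Fin s.1, η * (u (s.2 i.succ) - u (s.2 i.castSucc)) := by
    rw [← Finset.mul_sum, htot]; simp [indicator_apply]
  rw [e1, e2, leftSumOf, ← Finset.sum_sub_distrib]
  refine (Finset.abs_sum_le_sum_abs _ _).trans (Finset.sum_le_sum fun i _ => ?_)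
  have hi : s.2 i.castSucc ≤ s.2 i.succ := hs.1 (Fin.castSucc_lt_succ).le
  rw [smul_eq_mul, ← sub_mul, abs_mul, hinc _ _ (hs0 _) hi]
  by_cases hx : x ∈ Ioc (s.2 i.castSucc) (s.2 i.succ)
  · rw [indicator_of_mem hx, abs_one, mul_one, mul_one]
    have m1 := mem_Icc_of_mem_finePartitions hs i.castSucc
    have m2 := mem_Icc_of_mem_finePartitions hs i.succ
    refine hg _ m1 _ ⟨m1.1.trans hx.1.le, hx.2.trans m2.2⟩ ?_
    have := hs.2.2.2 i
    rw [abs_sub_comm, abs_of_nonneg (by linarith [hx.1])]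
    linarith [hx.2]
  · simp [indicator_of_notMem hx]

/-- The step functions of a continuous `g` converge in `L²` to `g` on `(a, b]`. -/
lemma tendsto_leftSumOf_cutoff {a b : ℝ} (ha : 0 ≤ a) {g : ℝ → ℝ}
    (hg : ContinuousOn g (Icc a b)) :
    Tendsto (leftSumOf g cutoff) (meshFilter a b)
      (𝓝 ((memLp_indicator_of_continuousOn hg).toLp _)) := by
  set one : Lp ℝ 2 (volume : Measure ℝ) :=
    indicatorConstLp 2 (measurableSet_Ioc : MeasurableSet (Ioc a b)) measure_Ioc_lt_top.ne 1
  rw [(hasBasis_meshFilter a b).tendsto_iff Metric.nhds_basis_closedBall]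
  intro r hr
  -- The `+ 1` in the witness avoids division by zero when `(a, b]` is empty.
  obtain ⟨η, hη, hηr⟩ : ∃ η : ℝ, 0 < η ∧ η * ‖one‖ ≤ r := by
    refine ⟨r / (‖one‖ + 1), by positivity, ?_⟩
    rw [div_mul_eq_mul_div, div_le_iff₀ (by positivity)]
    nlinarith [norm_nonneg one]
  obtain ⟨δ, hδ, h⟩ := Metric.uniformContinuousOn_iff_le.1
    (isCompact_Icc.uniformContinuousOn_of_continuous hg) η hη
  refine ⟨δ, hδ, fun s hs => ?_⟩
  rw [Metric.mem_closedBall, dist_eq_norm]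
  refine le_trans ?_ hηr
  rw [← Real.norm_of_nonneg hη.le, ← norm_smul]
  refine Lp.norm_le_norm_of_ae_le ?_
  filter_upwards [Lp.coeFn_sub (leftSumOf g cutoff s)
      ((memLp_indicator_of_continuousOn hg).toLp _),
    coeFn_leftSumOf (z := cutoff) g (fun _ => indicatorConstLp_coeFn) s,
    (memLp_indicator_of_continuousOn hg).coeFn_toLp, Lp.coeFn_smul η one,
    indicatorConstLp_coeFn (p := 2) (hs := (measurableSet_Ioc : MeasurableSet (Ioc a b)))
      (hμs := measure_Ioc_lt_top.ne) (c := (1 : ℝ))] with x h1 h2 h3 h4 h5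
  rw [h1, h4, Pi.sub_apply, Pi.smul_apply, h2, h3, h5, Real.norm_eq_abs, Real.norm_eq_abs]
  refine (abs_leftSumOf_indicator_sub_le ha h hs x).trans (le_abs_self _ |>.trans_eq' ?_)
  simp [indicator_apply]

/-- Left-point sums against a continuously differentiable function converge to the Riemann
integral against its derivative. -/
lemma tendsto_leftSumOf_of_integral {a b : ℝ} (ha : 0 ≤ a) (hab : a ≤ b) {g f φ : ℝ → ℝ}
    (hg : ContinuousOn g (Icc a b)) (hφ : ContinuousOn φ (Icc a b))
    (hf : ∀ t ∈ Icc a b, f t - f a = ∫ x in a..t, φ x) :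
    Tendsto (leftSumOf g f) (meshFilter a b) (𝓝 (∫ x in a..b, g x * φ x)) := by
  -- Since `f t - f a` is the inner product of `cutoff t` with `φ` on `(a, b]`, the sums against `f`
  -- are inner products of the converging step functions with a fixed vector.
  have h := (tendsto_const_nhds (x := (memLp_indicator_of_continuousOn hφ).toLp _)).inner
    (𝕜 := ℝ) (tendsto_leftSumOf_cutoff ha hg)
  have e : ⟪(memLp_indicator_of_continuousOn hφ).toLp _,
      (memLp_indicator_of_continuousOn hg).toLp _⟫ = ∫ x in a..b, g x * φ x := by
    rw [L2.inner_def, intervalIntegral.integral_of_le hab, ← integral_indicator measurableSet_Ioc]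
    refine integral_congr_ae ?_
    filter_upwards [(memLp_indicator_of_continuousOn hφ).coeFn_toLp,
      (memLp_indicator_of_continuousOn hg).coeFn_toLp] with x h1 h2
    rw [h1, h2]
    by_cases hx : x ∈ Ioc a b <;> simp [hx]
  rw [e] at h
  refine h.congr' ?_
  filter_upwards [(hasBasis_meshFilter a b).mem_of_mem one_pos] with s hs
  rw [inner_leftSumOf]
  refine (leftSumOf_congr (-f a) (fun t ht => ?_) hs)
  rw [real_inner_comm, inner_cutoff_toLp ha ht hφ, ← hf t ht, sub_eq_add_neg]

/-! ### Matrices acting on tuples of vectors, and Pythagoras for Gram matrices. -/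

section MatrixAction

variable {H : Type*} [NormedAddCommGroup H] [InnerProductSpace ℝ H]
  {l m n : Type*}

/-- The action of a real matrix on a tuple of vectors. -/
def act [Fintype n] (A : Matrix m n ℝ) (v : n → H) : m → H := fun i => ∑ j, A i j • v j

/-- The matrix of inner products of two tuples of vectors. -/
def crossGram (u : m → H) (v : n → H) : Matrix m n ℝ := Matrix.of fun i j => ⟪u i, v j⟫

lemma act_mul [Fintype m] [Fintype n] (A : Matrix l m ℝ) (B : Matrix m n ℝ) (v : n → H) :
    act (A * B) v = act A (act B v) := by
  ext i
  simp only [act, Matrix.mul_apply, Finset.sum_smul, Finset.smul_sum, mul_smul]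
  exact Finset.sum_comm

lemma act_add [Fintype n] (A : Matrix m n ℝ) (u v : n → H) : act A (u + v) = act A u + act A v := by
  ext i; simp [act, Finset.sum_add_distrib]

lemma crossGram_act_left [Fintype n] (A : Matrix m n ℝ) (u : n → H) (v : l → H) :
    crossGram (act A u) v = A * crossGram u v := by
  ext i j
  simp [crossGram, act, Matrix.mul_apply, sum_inner, real_inner_smul_left]

lemma crossGram_transpose (u : m → H) (v : n → H) : (crossGram u v)ᵀ = crossGram v u := by
  ext i j; exact real_inner_comm _ _

lemma crossGram_act_right [Fintype n] (A : Matrix m n ℝ) (u : l → H) (v : n → H) :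
    crossGram u (act A v) = crossGram u v * Aᵀ := by
  rw [← crossGram_transpose, crossGram_act_left, Matrix.transpose_mul, crossGram_transpose]

lemma crossGram_add_left (u u' : m → H) (v : n → H) :
    crossGram (u + u') v = crossGram u v + crossGram u' v := by
  ext i j; exact inner_add_left _ _ _

lemma crossGram_sub_left (u u' : m → H) (v : n → H) :
    crossGram (u - u') v = crossGram u v - crossGram u' v := by
  ext i j; exact inner_sub_left _ _ _

lemma crossGram_add_right (u : m → H) (v v' : n → H) :
    crossGram u (v + v') = crossGram u v + crossGram u v' := by
  ext i j; exact inner_add_right _ _ _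

lemma crossGram_sub_right (u : m → H) (v v' : n → H) :
    crossGram u (v - v') = crossGram u v - crossGram u v' := by
  ext i j; exact inner_sub_right _ _ _

lemma crossGram_sum_left {ι : Type*} [Fintype ι] (u : ι → m → H) (v : n → H) :
    crossGram (∑ i, u i) v = ∑ i, crossGram (u i) v := by
  ext i j; simp [crossGram, Matrix.sum_apply, sum_inner]

lemma crossGram_sum_right {ι : Type*} [Fintype ι] (u : m → H) (v : ι → n → H) :
    crossGram u (∑ i, v i) = ∑ i, crossGram u (v i) := by
  ext i j; simp [crossGram, Matrix.sum_apply, inner_sum]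

lemma posSemidef_crossGram [Finite m] (u : m → H) : (crossGram u u).PosSemidef :=
  Matrix.posSemidef_gram ℝ u

/-- Pythagoras: the hypothesis says that `u - v` is orthogonal to `v`. -/
lemma crossGram_sub_sub {u v : m → H} (h : crossGram u v = crossGram v v) :
    crossGram (u - v) (u - v) = crossGram u u - crossGram v v := by
  have h' : crossGram v u = crossGram v v := by
    rw [← crossGram_transpose, h, crossGram_transpose]
  rw [crossGram_sub_left, crossGram_sub_right, crossGram_sub_right, h, h', sub_self, sub_zero]

lemma crossGram_sub_comm (u v : m → H) : crossGram (u - v) (u - v) = crossGram (v - u) (v - u) := by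
  ext i j
  simp only [crossGram, Matrix.of_apply, ← neg_sub u v, Pi.neg_apply, inner_neg_neg]

/-- If `u` has the identity as cross-covariance with `v`, then the covariance of `u` exceeds that
of `(Cov v)⁻¹ v` by the covariance of `u - (Cov v)⁻¹ v`. -/
lemma crossGram_sub_act_inv [Fintype m] [DecidableEq m] {u v : m → H} (hu : crossGram u v = 1)
    (hv : IsUnit (crossGram v v)) :
    crossGram (u - act (crossGram v v)⁻¹ v) (u - act (crossGram v v)⁻¹ v) =
      crossGram u u - crossGram (act (crossGram v v)⁻¹ v) (act (crossGram v v)⁻¹ v) := by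
  refine crossGram_sub_sub ?_
  rw [crossGram_act_right, crossGram_act_right, crossGram_act_left, hu,
    Matrix.nonsing_inv_mul _ ((Matrix.isUnit_iff_isUnit_det _).1 hv)]

end MatrixAction

/-! ### Regularity of the regression functions. -/

section Regression

variable {p : ℕ} {F : ℝ → Matrix (Fin p) (Fin 2) ℝ} {a b : ℝ}

lemma IsC1.continuousOn_dotF (hF : IsC1 F a b) (hab : a < b) (k : Fin p) (l : Fin 2) :
    ContinuousOn (fun t => dotF F a b t k l) (Icc a b) :=
  (hF k l).continuousOn_derivWithin (uniqueDiffOn_Icc hab) le_rfl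

lemma IsC1.continuousOn_dotF_mul (hF : IsC1 F a b) (hab : a < b) {n : Type*} [Fintype n]
    (A : Matrix (Fin 2) n ℝ) (k : Fin p) (l : n) :
    ContinuousOn (fun t => (dotF F a b t * A) k l) (Icc a b) := by
  simp only [Matrix.mul_apply]
  exact continuousOn_finsetSum _ fun j _ => (hF.continuousOn_dotF hab k j).mul continuousOn_const

lemma IsC1.integral_dotF (hF : IsC1 F a b) (hab : a < b) (k : Fin p) (l : Fin 2) {t : ℝ}
    (ht : t ∈ Icc a b) : F t k l - F a k l = ∫ x in a..t, dotF F a b x k l := by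
  have hsub : Icc a t ⊆ Icc a b := Icc_subset_Icc_right ht.2
  refine (intervalIntegral.integral_eq_sub_of_hasDerivAt_of_le ht.1
    ((hF k l).continuousOn.mono hsub) (fun x hx => ?_) ?_).symm
  · have hx' : x ∈ Ioo a b := ⟨hx.1, hx.2.trans_le ht.2⟩
    exact ((hF k l).differentiableOn one_ne_zero x (Ioo_subset_Icc_self hx')).hasDerivWithinAt
      |>.hasDerivAt (Icc_mem_nhds hx'.1 hx'.2)
  · exact ContinuousOn.intervalIntegrable_of_Icc ht.1 ((hF.continuousOn_dotF hab k l).mono hsub)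

end Regression

/-! ### Abstract noise, its stochastic integrals and the score. -/

section Noise

variable {H : Type*} [NormedAddCommGroup H] [InnerProductSpace ℝ H]
  {S : Matrix (Fin 2) (Fin 2) ℝ} {p : ℕ} {F : ℝ → Matrix (Fin p) (Fin 2) ℝ} {a b : ℝ}

/-- `n` is a Hilbert space valued model of a two-dimensional Brownian motion with covariance
matrix `S`. -/
def IsNoise (S : Matrix (Fin 2) (Fin 2) ℝ) (n : ℝ → Fin 2 → H) : Prop :=
  ∀ s t i j, ⟪n s i, n t j⟫ = S i j * ⟪cutoff s, cutoff t⟫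

lemma IsNoise.crossGram_eq {n : ℝ → Fin 2 → H} (hn : IsNoise S n) {s t : ℝ} (hs : 0 ≤ s)
    (ht : 0 ≤ t) : crossGram (n s) (n t) = min s t • S := by
  ext i j
  rw [crossGram, Matrix.of_apply, hn, inner_cutoff_cutoff, Real.coe_toNNReal _ hs,
    Real.coe_toNNReal _ ht, Matrix.smul_apply, smul_eq_mul, mul_comm]

lemma IsNoise.exists_integral [CompleteSpace H] {n : ℝ → Fin 2 → H} (hn : IsNoise S n)
    (ha : 0 ≤ a) (hab : a ≤ b) {g : ℝ → ℝ} (hg : ContinuousOn g (Icc a b)) (l : Fin 2) :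
    ∃ x, Tendsto (leftSumOf g fun t => n t l) (meshFilter a b) (𝓝 x) := by
  have := neBot_meshFilter hab
  exact exists_tendsto_leftSumOf (fun s t => hn s t l l) (tendsto_leftSumOf_cutoff ha hg)

/-- Before the limit, this inner product is `S j i` times the one for `cutoff`, whose limit is the
ordinary integral up to `t`. -/
lemma IsNoise.inner_integral {n : ℝ → Fin 2 → H} (hn : IsNoise S n)
    (ha : 0 ≤ a) {t : ℝ} (ht : t ∈ Icc a b) {g : ℝ → ℝ} (hg : ContinuousOn g (Icc a b))
    {i j : Fin 2} {x : H} (hx : Tendsto (leftSumOf g fun t => n t i) (meshFilter a b) (𝓝 x)) :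
    ⟪n t j, x⟫ = S j i * ∫ u in a..t, g u := by
  have := neBot_meshFilter (ht.1.trans ht.2)
  refine tendsto_nhds_unique ((tendsto_const_nhds (x := n t j)).inner (𝕜 := ℝ) hx) ?_
  rw [← inner_cutoff_toLp ha ht hg]
  refine (((tendsto_const_nhds (x := cutoff t)).inner (𝕜 := ℝ)
    (tendsto_leftSumOf_cutoff ha hg)).const_mul (S j i)).congr fun s => ?_
  rw [inner_leftSumOf, inner_leftSumOf, ← leftSumOf_const_mul]
  simp only [hn t _ j i]

/-- The score vector `∫ Ḟ S⁻¹ dn + (1/a) F(a) S⁻¹ n(a)`, where `ξ k l` are the stochastic integrals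
of the entries of `Ḟ S⁻¹`. -/
def score (F : ℝ → Matrix (Fin p) (Fin 2) ℝ) (S : Matrix (Fin 2) (Fin 2) ℝ) (a : ℝ)
    (n : ℝ → Fin 2 → H) (ξ : Fin p → Fin 2 → H) : Fin p → H :=
  (fun k => ∑ l, ξ k l) + act ((1 / a) • (F a * S⁻¹)) (n a)

/-- `ξ k l` is the stochastic integral of the entry `(k, l)` of `Ḟ S⁻¹` against `n`. -/
def IsScoreIntegral (F : ℝ → Matrix (Fin p) (Fin 2) ℝ) (S : Matrix (Fin 2) (Fin 2) ℝ) (a b : ℝ)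
    (n : ℝ → Fin 2 → H) (ξ : Fin p → Fin 2 → H) : Prop :=
  ∀ k l, Tendsto (leftSumOf (fun t => (dotF F a b t * S⁻¹) k l) fun t => n t l) (meshFilter a b)
    (𝓝 (ξ k l))

/-- The reproducing property. The covariance `S` of the noise cancels `S⁻¹`, so the integral
contributes `∫ₐᵗ Ḟ = F t - F a`. The start term contributes `F a`, since `min a t = a` cancels `1 /
a`. -/
lemma IsNoise.crossGram_score {n : ℝ → Fin 2 → H} (hn : IsNoise S n) (hS : IsUnit S)
    (hST : Sᵀ = S) (hF : IsC1 F a b) (ha : 0 < a) (hab : a < b) {ξ : Fin p → Fin 2 → H}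
    (hξ : IsScoreIntegral F S a b n ξ) {t : ℝ} (ht : t ∈ Icc a b) :
    crossGram (score F S a n ξ) (n t) = F t := by
  have hd : IsUnit S.det := (Matrix.isUnit_iff_isUnit_det _).1 hS
  rw [score, crossGram_add_left, crossGram_act_left, hn.crossGram_eq ha.le (ha.le.trans ht.1),
    min_eq_left ht.1, Matrix.mul_smul, Matrix.smul_mul, smul_smul, mul_one_div_cancel ha.ne',
    one_smul, Matrix.mul_assoc, Matrix.nonsing_inv_mul _ hd, Matrix.mul_one]
  ext k j
  have hint : ∀ l, IntervalIntegrable (fun u => (dotF F a b u * S⁻¹) k l) volume a t := fun l =>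
    ContinuousOn.intervalIntegrable_of_Icc ht.1
      ((hF.continuousOn_dotF_mul hab S⁻¹ k l).mono (Icc_subset_Icc_right ht.2))
  have h : ∀ l, ⟪ξ k l, n t j⟫ = ∫ u in a..t, (dotF F a b u * S⁻¹) k l * S l j := fun l => by
    rw [real_inner_comm, hn.inner_integral ha.le ht (hF.continuousOn_dotF_mul hab _ _ _) (hξ k l),
      intervalIntegral.integral_mul_const, mul_comm, ← Matrix.transpose_apply S, hST]
  rw [Matrix.add_apply, crossGram, Matrix.of_apply, sum_inner]
  simp only [h]
  rw [← intervalIntegral.integral_finsetSum fun l _ => (hint l).mul_const _]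
  simp only [← Matrix.mul_apply, Matrix.mul_assoc, Matrix.nonsing_inv_mul _ hd, Matrix.mul_one]
  rw [← hF.integral_dotF hab k j ht, sub_add_cancel]

/-- Pairing the score with its own left-point sums replaces `n` by `F`, by the reproducing property;
these sums converge to `∫ Ḟ S⁻¹ Ḟᵀ`. -/
lemma IsNoise.crossGram_score_score {n : ℝ → Fin 2 → H} (hn : IsNoise S n) (hS : IsUnit S)
    (hST : Sᵀ = S) (hF : IsC1 F a b) (ha : 0 < a) (hab : a < b) {ξ : Fin p → Fin 2 → H}
    (hξ : IsScoreIntegral F S a b n ξ) :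
    crossGram (score F S a n ξ) (score F S a n ξ) = matM F S a b := by
  have hν : ∀ t ∈ Icc a b, crossGram (score F S a n ξ) (n t) = F t := fun t ht =>
    hn.crossGram_score hS hST hF ha hab hξ ht
  set ν := score F S a n ξ with hνdef
  have := neBot_meshFilter hab.le
  have h : ∀ k k' l, ⟪ν k', ξ k l⟫ =
      ∫ u in a..b, (dotF F a b u * S⁻¹) k l * dotF F a b u k' l := fun k k' l => by
    refine tendsto_nhds_unique ((tendsto_const_nhds (x := ν k')).inner (𝕜 := ℝ) (hξ k l)) ?_
    refine (tendsto_leftSumOf_of_integral ha.le hab.le (f := fun t => F t k' l)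
      (hF.continuousOn_dotF_mul hab _ _ _) (hF.continuousOn_dotF hab k' l)
      fun t ht => hF.integral_dotF hab k' l ht).congr' ?_
    filter_upwards [(hasBasis_meshFilter a b).mem_of_mem one_pos] with s hs
    rw [inner_leftSumOf]
    refine leftSumOf_congr 0 (fun t ht => ?_) hs
    rw [add_zero, ← hν t ht]
    rfl
  nth_rw 1 [hνdef]
  rw [score, crossGram_add_left, crossGram_act_left, ← crossGram_transpose ν (n a),
    hν a ⟨le_rfl, hab.le⟩, Matrix.smul_mul, matM]
  congr 1
  ext k k'
  rw [crossGram, Matrix.of_apply, sum_inner, matM₀, Matrix.of_apply]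
  simp only [real_inner_comm _ (ξ k _), h]
  rw [← intervalIntegral.integral_finsetSum]
  · simp only [Matrix.mul_apply (M := dotF F a b _ * S⁻¹), Matrix.transpose_apply]
  · exact fun l _ => ContinuousOn.intervalIntegrable_of_Icc hab.le
      ((hF.continuousOn_dotF_mul hab _ _ _).mul (hF.continuousOn_dotF hab _ _))

end Noise

/-! ### Random vectors as tuples in `L²(P)`; means and covariances. -/

section Representation

variable {Ω : Type*} [MeasurableSpace Ω] {P : Measure Ω} {m n : Type*}

/-- The random vector `X` is square integrable and its entries have the classes `x` in `L²(P)`. -/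
def IsRep (P : Measure Ω) (X : Ω → m → ℝ) (x : m → Lp ℝ 2 P) : Prop :=
  ∀ i, x i =ᵐ[P] fun ω => X ω i

lemma IsRep.memLp {X : Ω → m → ℝ} {x : m → Lp ℝ 2 P} (h : IsRep P X x) (i : m) :
    MemLp (fun ω => X ω i) 2 P :=
  (memLp_congr_ae (h i)).1 (Lp.memLp _)

lemma exists_isRep {X : Ω → m → ℝ} (h : ∀ i, MemLp (fun ω => X ω i) 2 P) : ∃ x, IsRep P X x :=
  ⟨fun i => (h i).toLp _, fun i => (h i).coeFn_toLp⟩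

lemma IsRep.add {X Y : Ω → m → ℝ} {x y : m → Lp ℝ 2 P} (hX : IsRep P X x) (hY : IsRep P Y y) :
    IsRep P (fun ω => X ω + Y ω) (x + y) :=
  fun i => (Lp.coeFn_add _ _).trans ((hX i).add (hY i))

lemma IsRep.sub {X Y : Ω → m → ℝ} {x y : m → Lp ℝ 2 P} (hX : IsRep P X x) (hY : IsRep P Y y) :
    IsRep P (fun ω => X ω - Y ω) (x - y) :=
  fun i => (Lp.coeFn_sub _ _).trans ((hX i).sub (hY i))

lemma IsRep.sum {ι : Type*} [Fintype ι] {X : ι → Ω → m → ℝ} {x : ι → m → Lp ℝ 2 P}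
    (h : ∀ j, IsRep P (X j) (x j)) : IsRep P (fun ω => ∑ j, X j ω) (∑ j, x j) := fun i => by
  simpa using coeFn_sum_smul (fun _ => 1) fun j => h j i

lemma IsRep.mulVec [Fintype n] {X : Ω → n → ℝ} {x : n → Lp ℝ 2 P} (h : IsRep P X x)
    (A : Matrix m n ℝ) : IsRep P (fun ω => A *ᵥ X ω) (act A x) := fun i =>
  coeFn_sum_smul (A i) h

lemma IsRep.integral_mul {X : Ω → m → ℝ} {x : m → Lp ℝ 2 P} {Y : Ω → n → ℝ} {y : n → Lp ℝ 2 P}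
    (hX : IsRep P X x) (hY : IsRep P Y y) (i : m) (j : n) :
    ∫ ω, X ω i * Y ω j ∂P = ⟪x i, y j⟫ := by
  rw [L2.inner_def]
  refine integral_congr_ae ?_
  filter_upwards [hX i, hY j] with ω h1 h2
  rw [h1, h2]
  exact mul_comm _ _

lemma IsRep.mseMatrix_eq {p : ℕ} {X Y : Ω → Fin p → ℝ} {x y : Fin p → Lp ℝ 2 P}
    (hX : IsRep P X x) (hY : IsRep P Y y) :
    mseMatrix X Y P = crossGram (x - y) (x - y) := by
  ext k l
  exact (hX.sub hY).integral_mul (hX.sub hY) k l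

lemma tendsto_eLpNorm_iff {ι : Type*} {f : Filter ι} {X : ι → Ω → ℝ} {Y : Ω → ℝ}
    {x : ι → Lp ℝ 2 P} {y : Lp ℝ 2 P} (hX : ∀ i, x i =ᵐ[P] X i) (hY : y =ᵐ[P] Y) :
    Tendsto (fun i => eLpNorm (fun ω => X i ω - Y ω) 2 P) f (𝓝 0) ↔ Tendsto x f (𝓝 y) := by
  rw [tendsto_iff_edist_tendsto_0]
  refine tendsto_congr fun i => ?_
  rw [Lp.edist_def]
  exact eLpNorm_congr_ae ((hX i).sub hY).symm

variable [IsProbabilityMeasure P]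

variable (P) in
/-- The class in `L²(P)` of the constant function one. -/
def oneLp : Lp ℝ 2 P := (memLp_const (1 : ℝ)).toLp _

variable (P) in
/-- The tuple of constant random variables with the values `c`. -/
def constLp (c : m → ℝ) : m → Lp ℝ 2 P := fun i => c i • oneLp P

lemma isRep_oneLp : IsRep P (fun _ (_ : Unit) => 1) (fun _ => oneLp P) :=
  fun _ => MemLp.coeFn_toLp _

lemma isRep_constLp (c : m → ℝ) : IsRep P (fun _ => c) (constLp P c) := fun i => by
  filter_upwards [Lp.coeFn_smul (c i) (oneLp P), isRep_oneLp (P := P) ()] with ω h1 h2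
  rw [constLp, h1, Pi.smul_apply, h2, smul_eq_mul, mul_one]

lemma IsRep.integral_eq {X : Ω → m → ℝ} {x : m → Lp ℝ 2 P} (h : IsRep P X x) (i : m) :
    ∫ ω, X ω i ∂P = ⟪oneLp P, x i⟫ := by
  simpa using isRep_oneLp.integral_mul h () i

lemma inner_oneLp_oneLp : ⟪oneLp P, oneLp P⟫ = 1 := by
  simpa using (isRep_oneLp.integral_eq (P := P) ()).symm

lemma act_constLp [Fintype n] (A : Matrix m n ℝ) (c : n → ℝ) :
    act A (constLp P c) = constLp P (A *ᵥ c) := by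
  ext1 i
  simp [act, constLp, Matrix.mulVec, dotProduct, Finset.sum_smul, mul_smul]

lemma constLp_add (c d : m → ℝ) : constLp P c + constLp P d = constLp P (c + d) := by
  ext1 i
  simp [constLp, add_smul]

lemma constLp_sub (c d : m → ℝ) : constLp P c - constLp P d = constLp P (c - d) := by
  ext1 i
  simp [constLp, sub_smul]

lemma constLp_sum {ι : Type*} [Fintype ι] (c : ι → m → ℝ) :
    ∑ j, constLp P (c j) = constLp P (∑ j, c j) := by
  ext1 i
  simp [constLp, Finset.sum_smul]

/-- The entries of `u` have mean zero. -/
def IsCentered (u : m → Lp ℝ 2 P) : Prop := ∀ i, ⟪oneLp P, u i⟫ = 0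

lemma IsCentered.add {u v : m → Lp ℝ 2 P} (hu : IsCentered u) (hv : IsCentered v) :
    IsCentered (u + v) := fun i => by
  rw [Pi.add_apply, inner_add_right, hu i, hv i, add_zero]

lemma IsCentered.sub {u v : m → Lp ℝ 2 P} (hu : IsCentered u) (hv : IsCentered v) :
    IsCentered (u - v) := fun i => by
  rw [Pi.sub_apply, inner_sub_right, hu i, hv i, sub_zero]

lemma IsCentered.sum {ι : Type*} [Fintype ι] {u : ι → m → Lp ℝ 2 P}
    (hu : ∀ j, IsCentered (u j)) : IsCentered (∑ j, u j) := fun i => by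
  rw [Finset.sum_apply, inner_sum]
  exact Finset.sum_eq_zero fun j _ => hu j i

lemma IsCentered.act [Fintype n] {u : n → Lp ℝ 2 P} (hu : IsCentered u) (A : Matrix m n ℝ) :
    IsCentered (act A u) := fun i => by
  rw [CurveDesign.act, inner_sum]
  exact Finset.sum_eq_zero fun j _ => by rw [real_inner_smul_right, hu j, mul_zero]

lemma IsCentered.inner_constLp_add {u : m → Lp ℝ 2 P} (hu : IsCentered u) (c : m → ℝ) (i : m) :
    ⟪oneLp P, (constLp P c + u) i⟫ = c i := by
  rw [Pi.add_apply, inner_add_right, hu i, add_zero, constLp, real_inner_smul_right,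
    inner_oneLp_oneLp, mul_one]

lemma IsRep.covMatrix_eq {p : ℕ} {X : Ω → Fin p → ℝ} {c : Fin p → ℝ} {u : Fin p → Lp ℝ 2 P}
    (h : IsRep P X (constLp P c + u)) (hu : IsCentered u) : covMatrix X P = crossGram u u := by
  ext k l
  rw [covMatrix, Matrix.of_apply, covariance_eq_sub (h.memLp k) (h.memLp l), h.integral_eq,
    h.integral_eq, hu.inner_constLp_add, hu.inner_constLp_add]
  have e : ∫ ω, X ω k * X ω l ∂P = _ := h.integral_mul h k l
  simp only [Pi.mul_apply, e, Pi.add_apply, constLp, inner_add_left, inner_add_right,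
    real_inner_smul_left, real_inner_smul_right, inner_oneLp_oneLp, hu k, hu l,
    real_inner_comm (oneLp P) (u k), crossGram, Matrix.of_apply]
  ring

/-- The mean is `Q *ᵥ θ`, and its values at the basis vectors determine `Q`. -/
lemma isUnbiased_iff {p : ℕ} {T : (Fin p → ℝ) → Ω → Fin p → ℝ} {Q : Matrix (Fin p) (Fin p) ℝ}
    {u : Fin p → Lp ℝ 2 P} (h : ∀ θ, IsRep P (T θ) (constLp P (Q *ᵥ θ) + u))
    (hu : IsCentered u) : IsUnbiased T P ↔ Q = 1 := by
  have e : ∀ θ k, ∫ ω, T θ ω k ∂P = (Q *ᵥ θ) k := fun θ k => by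
    rw [(h θ).integral_eq, hu.inner_constLp_add]
  constructor
  · intro hT
    refine Matrix.ext_of_mulVec_single fun j => funext fun k => ?_
    rw [← e, (hT _ k).2, Matrix.one_mulVec]
  · rintro rfl θ k
    exact ⟨((h θ).memLp k).integrable one_le_two, by rw [e, Matrix.one_mulVec]⟩

end Representation

/-! ### The stochastic integral as a limit in `L²(P)`. -/

section StochasticIntegral

variable {Ω : Type*} [MeasurableSpace Ω] {P : Measure Ω} {a b : ℝ}

lemma isStochIntegral_iff {g : ℝ → ℝ} {Z : ℝ → Ω → ℝ} {z : ℝ → Lp ℝ 2 P} {I : Ω → ℝ}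
    {x : Lp ℝ 2 P} (hz : ∀ t, z t =ᵐ[P] Z t) (hx : x =ᵐ[P] I) :
    IsStochIntegral g Z a b P I ↔ Tendsto (leftSumOf g z) (meshFilter a b) (𝓝 x) := by
  have e : ∀ s : Points, edist (leftSumOf g z s) x =
      eLpNorm (fun ω => leftSum g Z s.2 ω - I ω) 2 P := fun s => by
    rw [Lp.edist_def]
    exact eLpNorm_congr_ae ((coeFn_leftSumOf g hz s).sub hx)
  rw [(hasBasis_meshFilter a b).tendsto_iff Metric.nhds_basis_closedEBall]
  simp only [Metric.mem_closedEBall, e]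
  constructor
  · rintro ⟨-, h⟩ η hη
    obtain ⟨δ, hδ, h⟩ := h η hη
    exact ⟨δ, hδ, fun s hs => h s.1 s.2 hs.1 hs.2.1 hs.2.2.1 hs.2.2.2⟩
  · refine fun h => ⟨(memLp_congr_ae hx).1 (Lp.memLp x), fun η hη => ?_⟩
    obtain ⟨δ, hδ, h⟩ := h η hη
    exact ⟨δ, hδ, fun N s h1 h2 h3 h4 => h ⟨N, s⟩ ⟨h1, h2, h3, h4⟩⟩

/-- Whatever version is chosen in `stochIntegral`, uniqueness of mesh limits makes it agree almost
everywhere with a known limit. -/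
lemma stochIntegral_ae_eq (hab : a ≤ b) {g : ℝ → ℝ} {Z : ℝ → Ω → ℝ} {z : ℝ → Lp ℝ 2 P}
    {x : Lp ℝ 2 P} (hz : ∀ t, z t =ᵐ[P] Z t)
    (hx : Tendsto (leftSumOf g z) (meshFilter a b) (𝓝 x)) :
    x =ᵐ[P] stochIntegral g Z a b P := by
  have h : ∃ I, IsStochIntegral g Z a b P I := ⟨x, (isStochIntegral_iff hz (ae_eq_refl _)).2 hx⟩
  have hI := h.choose_spec
  have := neBot_meshFilter hab
  rw [stochIntegral, dif_pos h]
  rw [tendsto_nhds_unique hx ((isStochIntegral_iff hz hI.1.coeFn_toLp).1 hI)]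
  exact hI.1.coeFn_toLp

end StochasticIntegral

/-! ### Brownian pairs realise the abstract noise. -/

section Brownian

variable {Ω : Type*} [MeasurableSpace Ω] {P : Measure Ω} [IsProbabilityMeasure P]

lemma posDef_sigmaMat {σ₁ σ₂ ρ : ℝ} (hσ₁ : 0 < σ₁) (hσ₂ : 0 < σ₂) (hρ : ρ ∈ Ioo (-1 : ℝ) 1) :
    (sigmaMat σ₁ σ₂ ρ).PosDef := by
  refine Matrix.PosDef.of_dotProduct_mulVec_pos ?_ fun x hx => ?_
  · ext i j
    fin_cases i <;> fin_cases j <;> simp [sigmaMat]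
  · have hρ2 : 0 < 1 - ρ ^ 2 := by nlinarith [hρ.1, hρ.2]
    -- Completing the square in `σ₁ x₀`.
    have e : star x ⬝ᵥ sigmaMat σ₁ σ₂ ρ *ᵥ x =
        (σ₁ * x 0 + ρ * (σ₂ * x 1)) ^ 2 + (1 - ρ ^ 2) * (σ₂ * x 1) ^ 2 := by
      simp [sigmaMat, Matrix.mulVec, dotProduct, Fin.sum_univ_two]
      ring
    rw [e]
    by_cases h1 : x 1 = 0
    · have h0 : x 0 ≠ 0 := fun h0 => hx (by ext i; fin_cases i <;> simp [h0, h1])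
      have : 0 < (σ₁ * x 0) ^ 2 := by positivity
      simpa [h1] using this
    · positivity

/-- By independence `ε` has covariance `min s t` times the identity; the symmetric root acting on
both sides turns the identity into `S`. -/
lemma IsBrownianPair.exists_noise {ε : Fin 2 → ℝ≥0 → Ω → ℝ} (hε : IsBrownianPair ε P)
    {S : Matrix (Fin 2) (Fin 2) ℝ} (hS : S.PosSemidef) :
    ∃ n : ℝ → Fin 2 → Lp ℝ 2 P, IsNoise S n ∧ (∀ t, IsCentered (n t)) ∧
      ∀ t : ℝ, IsRep P (fun ω => CFC.sqrt S *ᵥ fun j => ε j t.toNNReal ω) (n t) := by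
  have hL : ∀ j t, MemLp (ε j t) 2 P := fun j t =>
    ((hε.brownian j).hasLaw_eval t).hasGaussianLaw.memLp_two
  set e : ℝ → Fin 2 → Lp ℝ 2 P := fun t j => (hL j t.toNNReal).toLp _ with he
  have hrep : ∀ t : ℝ, IsRep P (fun ω j => ε j t.toNNReal ω) (e t) := fun t j => MemLp.coeFn_toLp _
  have hmean : ∀ j (t : ℝ≥0), ∫ ω, ε j t ω ∂P = 0 := fun j t => (hε.brownian j).integral_eval t
  have hcov : ∀ s t : ℝ≥0, ∀ i j, ∫ ω, ε i s ω * ε j t ω ∂P =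
      (1 : Matrix (Fin 2) (Fin 2) ℝ) i j * min s t := by
    intro s t i j
    have h1 : cov[ε i s, ε j t; P] = ∫ ω, ε i s ω * ε j t ω ∂P := by
      rw [covariance_eq_sub (hL i s) (hL j t), hmean, hmean, mul_zero, sub_zero]
      rfl
    rw [← h1]
    have hind : ∀ s t, cov[ε 0 s, ε 1 t; P] = 0 := fun s t =>
      (hε.indep.comp (measurable_pi_apply s) (measurable_pi_apply t)).covariance_eq_zero
        (hL 0 s) (hL 1 t)
    rcases eq_or_ne i j with rfl | hij
    · rw [(hε.brownian i).covariance_eval, Matrix.one_apply_eq, one_mul]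
    · rw [Matrix.one_apply_ne hij, zero_mul]
      fin_cases i <;> fin_cases j
      · exact absurd rfl hij
      · exact hind s t
      · exact (covariance_comm _ _).trans (hind t s)
      · exact absurd rfl hij
  have hgram : ∀ s t, crossGram (e s) (e t) = ⟪cutoff s, cutoff t⟫ • 1 := by
    intro s t
    ext i j
    rw [crossGram, Matrix.of_apply, ← (hrep s).integral_mul (hrep t), hcov, inner_cutoff_cutoff,
      Matrix.smul_apply, smul_eq_mul, mul_comm, NNReal.coe_min]
  have hR : (CFC.sqrt S)ᵀ = CFC.sqrt S := by
    have := (Matrix.nonneg_iff_posSemidef.1 (CFC.sqrt_nonneg S)).isHermitian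
    rwa [Matrix.IsHermitian, Matrix.conjTranspose_eq_transpose_of_trivial] at this
  refine ⟨fun t => act (CFC.sqrt S) (e t), fun s t i j => ?_, fun t => ?_, fun t => ?_⟩
  · have : crossGram (act (CFC.sqrt S) (e s)) (act (CFC.sqrt S) (e t)) =
        ⟪cutoff s, cutoff t⟫ • S := by
      rw [crossGram_act_left, crossGram_act_right, hgram, hR, Matrix.smul_mul, Matrix.one_mul,
        Matrix.mul_smul, CFC.sqrt_mul_sqrt_self S (Matrix.nonneg_iff_posSemidef.2 hS)]
    rw [mul_comm]
    exact congrFun (congrFun this i) j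
  · exact IsCentered.act (fun j => by rw [← (hrep t).integral_eq, hmean]) _
  · exact (hrep t).mulVec _

end Brownian

/-! ### Finite linear combinations of observations and the discrete noise. -/

section Design

variable {H : Type*} [NormedAddCommGroup H] [InnerProductSpace ℝ H] {p : ℕ}
  {F : ℝ → Matrix (Fin p) (Fin 2) ℝ} {S : Matrix (Fin 2) (Fin 2) ℝ} {a b : ℝ}
  {n : ℝ → Fin 2 → H}

/-- The observation times used by the left-point sum along `s` and at time `a`. -/
def sumTimes (a : ℝ) (s : Points) : Option (Fin s.1 ⊕ Fin s.1) → ℝ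
  | none => a
  | some (Sum.inl i) => s.2 i.succ
  | some (Sum.inr i) => s.2 i.castSucc

/-- The weights of the observations in the left-point approximation of the continuous time
estimator along `s`. -/
def sumWeights (F : ℝ → Matrix (Fin p) (Fin 2) ℝ) (S : Matrix (Fin 2) (Fin 2) ℝ) (a b : ℝ)
    (s : Points) : Option (Fin s.1 ⊕ Fin s.1) → Matrix (Fin p) (Fin 2) ℝ
  | none => (matM F S a b)⁻¹ * ((1 / a) • (F a * S⁻¹))
  | some (Sum.inl i) => (matM F S a b)⁻¹ * (dotF F a b (s.2 i.castSucc) * S⁻¹)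
  | some (Sum.inr i) => -((matM F S a b)⁻¹ * (dotF F a b (s.2 i.castSucc) * S⁻¹))

/-- Exhibits the approximation of the continuous time estimator as a finite sum of observations with
weights free of `θ`; each increment is split into its two end points. -/
lemma sum_act_sumWeights (s : Points) (y : ℝ → Fin 2 → H) :
    ∑ i, act (sumWeights F S a b s i) (y (sumTimes a s i)) =
      act (matM F S a b)⁻¹ ((fun k => ∑ l, leftSumOf (fun t => (dotF F a b t * S⁻¹) k l)
        (fun t => y t l) s) + act ((1 / a) • (F a * S⁻¹)) (y a)) := by
  have e : (fun k => ∑ l, leftSumOf (fun t => (dotF F a b t * S⁻¹) k l) (fun t => y t l) s) =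
      ∑ i : Fin s.1, act (dotF F a b (s.2 i.castSucc) * S⁻¹)
        (y (s.2 i.succ) - y (s.2 i.castSucc)) := by
    ext1 k
    rw [Finset.sum_apply]
    exact Finset.sum_comm
  have hneg : ∀ (A : Matrix (Fin p) (Fin 2) ℝ) (v w : Fin 2 → H),
      act A v + act (-A) w = act A (v - w) := fun A v w => by
    ext1 k
    simp only [act, Pi.add_apply, Matrix.neg_apply, neg_smul, Pi.sub_apply, smul_sub,
      Finset.sum_sub_distrib, Finset.sum_neg_distrib]
    exact (sub_eq_add_neg _ _).symm
  have hsum : ∀ (A : Matrix (Fin p) (Fin p) ℝ) (v : Fin s.1 → Fin p → H),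
      act A (∑ i, v i) = ∑ i, act A (v i) := fun A v => by
    ext1 k
    simp only [act, Finset.sum_apply, Finset.smul_sum]
    exact Finset.sum_comm
  rw [e, act_add, hsum, Fintype.sum_option, Fintype.sum_sum_type, ← Finset.sum_add_distrib,
    add_comm]
  simp only [sumWeights, sumTimes, hneg]
  simp only [act_mul (matM F S a b)⁻¹]

/-- The noise part of the bracket of the discrete estimator. -/
def discreteNoise (F : ℝ → Matrix (Fin p) (Fin 2) ℝ) (S : Matrix (Fin 2) (Fin 2) ℝ) (a : ℝ)
    (n : ℝ → Fin 2 → H) {m : ℕ} (t : Fin (m + 1) → ℝ)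
    (Φ : Fin m → Matrix (Fin p) (Fin 2) ℝ) : Fin p → H :=
  (∑ i : Fin m, act (Φ i * S⁻¹) (n (t i.succ) - n (t i.castSucc))) +
    act ((1 / a) • (F a * S⁻¹)) (n a)

/-- The matrix `∑ᵢ Φᵢ S⁻¹ (F(tᵢ) - F(tᵢ₋₁))ᵀ`. -/
def designMat (F : ℝ → Matrix (Fin p) (Fin 2) ℝ) (S : Matrix (Fin 2) (Fin 2) ℝ) {m : ℕ}
    (t : Fin (m + 1) → ℝ) (Φ : Fin m → Matrix (Fin p) (Fin 2) ℝ) : Matrix (Fin p) (Fin p) ℝ :=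
  ∑ i : Fin m, Φ i * S⁻¹ * (F (t i.succ) - F (t i.castSucc))ᵀ

variable {m : ℕ} {t : Fin (m + 1) → ℝ} {Φ : Fin m → Matrix (Fin p) (Fin 2) ℝ}

lemma mem_Icc_of_strictMono (ht : StrictMono t) (hta : t 0 = a) (htb : t (Fin.last m) = b)
    (i : Fin (m + 1)) : t i ∈ Icc a b :=
  ⟨hta ▸ ht.monotone (Fin.zero_le i), htb ▸ ht.monotone (Fin.le_last i)⟩

/-- The right-hand side is also the coefficient of `θ` in the mean of the bracket; this coincidence
translates unbiasedness into a covariance with the score. -/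
lemma crossGram_discreteNoise_left (ht : StrictMono t) (hta : t 0 = a) (htb : t (Fin.last m) = b)
    (hab : a ≤ b) {ν : Fin p → H} (hνn : ∀ u ∈ Icc a b, crossGram (n u) ν = (F u)ᵀ) :
    crossGram (discreteNoise F S a n t Φ) ν =
      designMat F S t Φ + (1 / a) • (F a * S⁻¹ * (F a)ᵀ) := by
  simp only [discreteNoise, crossGram_add_left, crossGram_sum_left, crossGram_act_left,
    crossGram_sub_left, hνn _ (mem_Icc_of_strictMono ht hta htb _), hνn a ⟨le_rfl, hab⟩,
    designMat, Matrix.transpose_sub, Matrix.smul_mul]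

/-- The matrix `∑ᵢ (tᵢ - tᵢ₋₁) Φᵢ S⁻¹ Ψᵢᵀ`. -/
def weightMat (S : Matrix (Fin 2) (Fin 2) ℝ) {m : ℕ} (t : Fin (m + 1) → ℝ)
    (Φ Ψ : Fin m → Matrix (Fin p) (Fin 2) ℝ) : Matrix (Fin p) (Fin p) ℝ :=
  ∑ i : Fin m, (t i.succ - t i.castSucc) • (Φ i * S⁻¹ * (Ψ i)ᵀ)

lemma IsNoise.crossGram_increments (hN : IsNoise S n) (ht : StrictMono t) (h0 : 0 ≤ t 0)
    (i j : Fin m) : crossGram (n (t i.succ) - n (t i.castSucc)) (n (t j.succ) - n (t j.castSucc)) =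
      if i = j then (t i.succ - t i.castSucc) • S else 0 := by
  have hpos : ∀ i, 0 ≤ t i := fun i => h0.trans (ht.monotone (Fin.zero_le i))
  simp only [crossGram_sub_left, crossGram_sub_right, hN.crossGram_eq (hpos _) (hpos _), ← sub_smul]
  have hi := ht (Fin.castSucc_lt_succ (i := i))
  have hj := ht (Fin.castSucc_lt_succ (i := j))
  rcases lt_trichotomy i j with h | rfl | h
  · have h1 : t i.succ ≤ t j.castSucc := ht.monotone (Fin.succ_le_castSucc_iff.2 h)
    rw [if_neg h.ne, min_eq_left (by linarith), min_eq_left (by linarith),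
      min_eq_left (by linarith), min_eq_left (by linarith)]
    simp
  · rw [if_pos rfl, min_self, min_self, min_eq_right hi.le, min_eq_left hi.le]
    simp
  · have h1 : t j.succ ≤ t i.castSucc := ht.monotone (Fin.succ_le_castSucc_iff.2 h)
    rw [if_neg h.ne', min_eq_right (by linarith), min_eq_right (by linarith),
      min_eq_right (by linarith), min_eq_right (by linarith)]
    simp

lemma IsNoise.crossGram_increment_start (hN : IsNoise S n) (ht : StrictMono t) (hta : t 0 = a)
    (ha : 0 ≤ a) (i : Fin m) : crossGram (n (t i.succ) - n (t i.castSucc)) (n a) = 0 := by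
  have h : ∀ i, a ≤ t i := fun i => hta ▸ ht.monotone (Fin.zero_le i)
  rw [crossGram_sub_left, hN.crossGram_eq (ha.trans (h _)) ha, hN.crossGram_eq (ha.trans (h _)) ha,
    min_eq_right (h _), min_eq_right (h _), sub_self]

/-- Increments are orthogonal to each other and to `n a`, so the double sum collapses to its
diagonal; in the start term `a` cancels one of the two factors `1 / a`. -/
lemma IsNoise.crossGram_discreteNoise (hN : IsNoise S n) (hS : IsUnit S) (hST : Sᵀ = S)
    (ht : StrictMono t) (hta : t 0 = a) (ha : 0 < a) (Φ Ψ : Fin m → Matrix (Fin p) (Fin 2) ℝ) :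
    crossGram (discreteNoise F S a n t Φ) (discreteNoise F S a n t Ψ) =
      weightMat S t Φ Ψ + (1 / a) • (F a * S⁻¹ * (F a)ᵀ) := by
  have hd : IsUnit S.det := (Matrix.isUnit_iff_isUnit_det _).1 hS
  have hSi : (S⁻¹)ᵀ = S⁻¹ := by rw [Matrix.transpose_nonsing_inv, hST]
  have h0 : ∀ i : Fin m, crossGram (n a) (n (t i.succ) - n (t i.castSucc)) = 0 := fun i => by
    rw [← crossGram_transpose, hN.crossGram_increment_start ht hta ha.le, Matrix.transpose_zero]
  have hSS : ∀ A C : Matrix (Fin p) (Fin 2) ℝ, A * S⁻¹ * S * (C * S⁻¹)ᵀ = A * S⁻¹ * Cᵀ :=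
    fun A C => by
      rw [Matrix.transpose_mul, hSi, Matrix.nonsing_inv_mul_cancel_right _ _ hd, Matrix.mul_assoc]
  simp only [discreteNoise, crossGram_add_left, crossGram_add_right, crossGram_sum_left,
    crossGram_sum_right, crossGram_act_left, crossGram_act_right,
    hN.crossGram_increments ht (hta ▸ ha.le), hN.crossGram_increment_start ht hta ha.le, h0,
    hN.crossGram_eq ha.le ha.le, min_self, Matrix.mul_zero,
    Finset.sum_const_zero, add_zero, zero_add]
  congr 1
  · rw [weightMat]
    refine Finset.sum_congr rfl fun i _ => ?_
    rw [Finset.sum_eq_single i]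
    · rw [if_pos rfl, Matrix.mul_smul, Matrix.smul_mul, hSS]
    · intro j _ hj
      simp [hj]
    · simp
  · rw [Matrix.transpose_smul, Matrix.smul_mul, Matrix.smul_mul, Matrix.mul_smul, Matrix.mul_smul,
      Matrix.smul_mul, hSS, smul_smul, smul_smul]
    congr 1
    field_simp

end Design

/-! ### The estimators in `L²(P)`: drift plus noise. -/

section Model

variable {Ω : Type*} [MeasurableSpace Ω] {P : Measure Ω} [IsProbabilityMeasure P]
  {ε : Fin 2 → ℝ≥0 → Ω → ℝ} {p : ℕ} {F : ℝ → Matrix (Fin p) (Fin 2) ℝ}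
  {S : Matrix (Fin 2) (Fin 2) ℝ} {a b : ℝ} {n : ℝ → Fin 2 → Lp ℝ 2 P}
  {ξ : Fin p → Fin 2 → Lp ℝ 2 P}

/-- The observations in `L²(P)`, with noise `n`, under the parameter `θ`. -/
def obsLp (F : ℝ → Matrix (Fin p) (Fin 2) ℝ) (n : ℝ → Fin 2 → Lp ℝ 2 P) (θ : Fin p → ℝ) (t : ℝ) :
    Fin 2 → Lp ℝ 2 P :=
  constLp P ((F t)ᵀ *ᵥ θ) + n t

/-- `n` represents the noise `S^{1/2} ε`. -/
def RepresentsNoise (S : Matrix (Fin 2) (Fin 2) ℝ) (ε : Fin 2 → ℝ≥0 → Ω → ℝ)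
    (n : ℝ → Fin 2 → Lp ℝ 2 P) : Prop :=
  ∀ t : ℝ, IsRep P (fun ω => CFC.sqrt S *ᵥ fun j => ε j t.toNNReal ω) (n t)

lemma RepresentsNoise.isRep_obs (hn : RepresentsNoise S ε n) (θ : Fin p → ℝ) (t : ℝ) :
    IsRep P (obs F S ε θ t) (obsLp F n θ t) :=
  (isRep_constLp _).add (hn t)

lemma IsScoreIntegral.isCentered_score (hξ : IsScoreIntegral F S a b n ξ) (hab : a ≤ b)
    (hc : ∀ t, IsCentered (n t)) : IsCentered (score F S a n ξ) := by
  have := neBot_meshFilter hab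
  refine IsCentered.add (fun k => ?_) ((hc a).act _)
  rw [inner_sum]
  refine Finset.sum_eq_zero fun l _ => tendsto_nhds_unique
    ((tendsto_const_nhds (x := oneLp P)).inner (𝕜 := ℝ) (hξ k l)) ?_
  refine tendsto_const_nhds.congr fun s => ?_
  rw [inner_leftSumOf]
  simp [leftSumOf, hc _ l]

/-- The stochastic integral of the entry `(k, l)` of `Ḟ S⁻¹` against the observations. -/
def obsIntegral (F : ℝ → Matrix (Fin p) (Fin 2) ℝ) (S : Matrix (Fin 2) (Fin 2) ℝ) (a b : ℝ)
    (ξ : Fin p → Fin 2 → Lp ℝ 2 P) (θ : Fin p → ℝ) (k : Fin p) (l : Fin 2) : Lp ℝ 2 P :=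
  (∫ u in a..b, (dotF F a b u * S⁻¹) k l * ((dotF F a b u)ᵀ *ᵥ θ) l) • oneLp P + ξ k l

lemma IsScoreIntegral.tendsto_obsIntegral (hξ : IsScoreIntegral F S a b n ξ) (hF : IsC1 F a b)
    (ha : 0 ≤ a) (hab : a < b) (θ : Fin p → ℝ) (k : Fin p) (l : Fin 2) :
    Tendsto (leftSumOf (fun t => (dotF F a b t * S⁻¹) k l) fun t => obsLp F n θ t l)
      (meshFilter a b) (𝓝 (obsIntegral F S a b ξ θ k l)) := by
  have hcont : ∀ j, ContinuousOn (fun u => dotF F a b u j l * θ j) (Icc a b) := fun j =>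
    (hF.continuousOn_dotF hab j l).mul continuousOn_const
  have hd : Tendsto (leftSumOf (fun t => (dotF F a b t * S⁻¹) k l) fun t => ((F t)ᵀ *ᵥ θ) l)
      (meshFilter a b)
      (𝓝 (∫ u in a..b, (dotF F a b u * S⁻¹) k l * ((dotF F a b u)ᵀ *ᵥ θ) l)) := by
    refine tendsto_leftSumOf_of_integral ha hab.le (hF.continuousOn_dotF_mul hab _ _ _) ?_ ?_
    · simp only [Matrix.mulVec, dotProduct, Matrix.transpose_apply]
      exact continuousOn_finsetSum _ fun j _ => hcont j
    · intro t ht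
      simp only [Matrix.mulVec, dotProduct, Matrix.transpose_apply]
      rw [intervalIntegral.integral_finsetSum fun j _ =>
        ContinuousOn.intervalIntegrable_of_Icc ht.1
          ((hcont j).mono (Icc_subset_Icc_right ht.2)), ← Finset.sum_sub_distrib]
      refine Finset.sum_congr rfl fun j _ => ?_
      rw [intervalIntegral.integral_mul_const, ← hF.integral_dotF hab j l ht, sub_mul]
  refine ((hd.smul_const (oneLp P)).add (hξ k l)).congr fun s => ?_
  rw [← leftSumOf_smul_const, ← leftSumOf_add]
  rfl

lemma sum_obsIntegral (hF : IsC1 F a b) (hab : a < b) (θ : Fin p → ℝ) :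
    (fun k => ∑ l, obsIntegral F S a b ξ θ k l) =
      constLp P (matM₀ F S a b *ᵥ θ) + fun k => ∑ l, ξ k l := by
  ext1 k
  simp only [obsIntegral, Finset.sum_add_distrib, ← Finset.sum_smul, Pi.add_apply, constLp]
  congr 2
  have hc : ∀ j l, ContinuousOn (fun u => (dotF F a b u * S⁻¹) k l * dotF F a b u j l) (Icc a b) :=
    fun j l => (hF.continuousOn_dotF_mul hab _ _ _).mul (hF.continuousOn_dotF hab _ _)
  have hi : ∀ j l, IntervalIntegrable (fun u => (dotF F a b u * S⁻¹) k l * dotF F a b u j l)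
      volume a b := fun j l => ContinuousOn.intervalIntegrable_of_Icc hab.le (hc j l)
  simp only [Matrix.mulVec, dotProduct, matM₀, Matrix.of_apply, Matrix.transpose_apply,
    Matrix.mul_apply (M := dotF F a b _ * S⁻¹), Finset.mul_sum, ← mul_assoc]
  have e1 : ∀ l, ∫ u in a..b, ∑ j, (dotF F a b u * S⁻¹) k l * dotF F a b u j l * θ j =
      ∑ j, (∫ u in a..b, (dotF F a b u * S⁻¹) k l * dotF F a b u j l) * θ j := fun l => by
    rw [intervalIntegral.integral_finsetSum fun j _ => (hi j l).mul_const _]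
    simp only [intervalIntegral.integral_mul_const]
  have e2 : ∀ j, ∫ u in a..b, ∑ l, (dotF F a b u * S⁻¹) k l * dotF F a b u j l =
      ∑ l, ∫ u in a..b, (dotF F a b u * S⁻¹) k l * dotF F a b u j l := fun j =>
    intervalIntegral.integral_finsetSum fun l _ => hi j l
  simp only [e1, e2, Finset.sum_mul]
  exact Finset.sum_comm

/-- The continuous time estimator in `L²(P)`. -/
def blueLp (F : ℝ → Matrix (Fin p) (Fin 2) ℝ) (S : Matrix (Fin 2) (Fin 2) ℝ) (a b : ℝ)
    (n : ℝ → Fin 2 → Lp ℝ 2 P) (ξ : Fin p → Fin 2 → Lp ℝ 2 P) (θ : Fin p → ℝ) :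
    Fin p → Lp ℝ 2 P :=
  act (matM F S a b)⁻¹ ((fun k => ∑ l, obsIntegral F S a b ξ θ k l) +
    act ((1 / a) • (F a * S⁻¹)) (obsLp F n θ a))

lemma isRep_thetaBLUE (hn : RepresentsNoise S ε n) (hξ : IsScoreIntegral F S a b n ξ)
    (hF : IsC1 F a b) (ha : 0 ≤ a) (hab : a < b) (θ : Fin p → ℝ) :
    IsRep P (thetaBLUE F S a b ε P θ) (blueLp F S a b n ξ θ) := by
  refine (IsRep.add (fun k => ?_) ((hn.isRep_obs θ a).mulVec _)).mulVec _
  have h : ∀ l, obsIntegral F S a b ξ θ k l =ᵐ[P] stochIntegral (fun t => (dotF F a b t * S⁻¹) k l)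
      (fun t ω => obs F S ε θ t ω l) a b P := fun l =>
    stochIntegral_ae_eq hab.le (fun t => hn.isRep_obs θ t l)
      (hξ.tendsto_obsIntegral hF ha hab θ k l)
  simpa [stochIntegralVec] using coeFn_sum_smul (fun _ => 1) h

/-- The drift of the bracket is `M₀ θ` from the integral plus the start term, that is `M θ`, and
`M⁻¹` recovers `θ`. -/
lemma blueLp_eq (hF : IsC1 F a b) (hab : a < b) (hM : IsUnit (matM F S a b)) (θ : Fin p → ℝ) :
    blueLp F S a b n ξ θ = constLp P θ + act (matM F S a b)⁻¹ (score F S a n ξ) := by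
  have hd : IsUnit (matM F S a b).det := (Matrix.isUnit_iff_isUnit_det _).1 hM
  rw [blueLp, sum_obsIntegral hF hab, obsLp, act_add _ (constLp P _), act_constLp,
    add_add_add_comm, constLp_add, Matrix.mulVec_mulVec, ← Matrix.add_mulVec, Matrix.smul_mul,
    ← matM, act_add, act_constLp, Matrix.mulVec_mulVec, Matrix.nonsing_inv_mul _ hd,
    Matrix.one_mulVec, score]

lemma isLinearEstimator_of_tendsto (hn : RepresentsNoise S ε n)
    {T : (Fin p → ℝ) → Ω → Fin p → ℝ} {τ : (Fin p → ℝ) → Fin p → Lp ℝ 2 P}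
    (hT : ∀ θ, IsRep P (T θ) (τ θ)) {ι : ℕ → Type} [∀ N, Fintype (ι N)]
    (s : ∀ N, ι N → ℝ) (C : ∀ N, ι N → Matrix (Fin p) (Fin 2) ℝ) (hs : ∀ N i, s N i ∈ Icc a b)
    (h : ∀ θ, Tendsto (fun N => ∑ i, act (C N i) (obsLp F n θ (s N i))) atTop (𝓝 (τ θ))) :
    IsLinearEstimator F S a b ε P T := by
  refine ⟨fun θ => (hT θ).memLp, fun N => Fintype.card (ι N),
    fun N i => s N ((Fintype.equivFin (ι N)).symm i),
    fun N i => C N ((Fintype.equivFin (ι N)).symm i), fun N i => hs N _, fun θ k => ?_⟩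
  rw [tendsto_eLpNorm_iff (fun N => IsRep.sum (fun i => (hn.isRep_obs θ _).mulVec _) k) (hT θ k)]
  refine (tendsto_pi_nhds.1 (h θ) k).congr fun N => ?_
  rw [← Equiv.sum_comp (Fintype.equivFin (ι N)).symm]

lemma isLinearEstimator_thetaBLUE (hn : RepresentsNoise S ε n) (hξ : IsScoreIntegral F S a b n ξ)
    (hF : IsC1 F a b) (ha : 0 ≤ a) (hab : a < b) :
    IsLinearEstimator F S a b ε P (thetaBLUE F S a b ε P) := by
  refine isLinearEstimator_of_tendsto hn (isRep_thetaBLUE hn hξ hF ha hab)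
    (fun N => sumTimes a (uniformPoints a b N)) (fun N => sumWeights F S a b (uniformPoints a b N))
    (fun N i => ?_) fun θ => ?_
  · have hm : ∀ i, (uniformPoints a b N).2 i ∈ Icc a b :=
      mem_Icc_of_mem_finePartitions (uniformPoints_mem_finePartitions hab.le N)
    rcases i with _ | i | i
    · exact ⟨le_rfl, hab.le⟩
    · exact hm _
    · exact hm _
  · simp only [sum_act_sumWeights]
    have h : Tendsto (fun N k => ∑ l, leftSumOf (fun t => (dotF F a b t * S⁻¹) k l)
        (fun t => obsLp F n θ t l) (uniformPoints a b N)) atTop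
        (𝓝 fun k => ∑ l, obsIntegral F S a b ξ θ k l) :=
      tendsto_pi_nhds.2 fun k => tendsto_finsetSum _ fun l _ =>
        (hξ.tendsto_obsIntegral hF ha hab θ k l).comp (tendsto_uniformPoints hab.le)
    have hcont : Continuous (act (H := Lp ℝ 2 P) (matM F S a b)⁻¹) := by
      unfold act
      fun_prop
    exact (hcont.tendsto _).comp (h.add tendsto_const_nhds)

/-- A linear unbiased estimator is the parameter plus a centred vector whose cross-covariance with
the score is the identity. -/
lemma IsLinearEstimator.exists_isRep (hn : RepresentsNoise S ε n) (hc : ∀ t, IsCentered (n t))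
    {ν : Fin p → Lp ℝ 2 P} (hν : IsCentered ν)
    (hνn : ∀ t ∈ Icc a b, crossGram (n t) ν = (F t)ᵀ) {T : (Fin p → ℝ) → Ω → Fin p → ℝ}
    (hT : IsLinearEstimator F S a b ε P T) (hu : IsUnbiased T P) (θ : Fin p → ℝ) :
    ∃ u, IsCentered u ∧ IsRep P (T θ) (constLp P θ + u) ∧ crossGram u ν = 1 := by
  obtain ⟨hL, N, s, C, hs, hlim⟩ := hT
  choose τ hτ using fun θ => CurveDesign.exists_isRep (hL θ)
  have hlim' : ∀ θ k, Tendsto (fun j => (∑ i, act (C j i) (obsLp F n θ (s j i))) k) atTop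
      (𝓝 (τ θ k)) := fun θ k =>
    (tendsto_eLpNorm_iff (fun j => IsRep.sum (fun i => (hn.isRep_obs θ _).mulVec _) k)
      (hτ θ k)).1 (hlim θ k)
  have hmean : ∀ θ k, ⟪oneLp P, τ θ k⟫ = θ k := fun θ k => by
    rw [← (hτ θ).integral_eq, (hu θ k).2]
  set A : ℕ → Matrix (Fin p) (Fin p) ℝ := fun j => ∑ i, C j i * (F (s j i))ᵀ with hA
  set w : ℕ → Fin p → Lp ℝ 2 P := fun j => ∑ i, act (C j i) (n (s j i)) with hw
  have hwc : ∀ j, IsCentered (w j) := fun j => IsCentered.sum fun i => (hc _).act _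
  have hdec : ∀ θ j, ∑ i, act (C j i) (obsLp F n θ (s j i)) = constLp P (A j *ᵥ θ) + w j := by
    intro θ j
    simp only [obsLp, act_add, act_constLp, Finset.sum_add_distrib, constLp_sum, hA, hw,
      Matrix.sum_mulVec, Matrix.mulVec_mulVec]
  -- The matrix `A j` governing the mean reappears as the covariance with `ν`. Unbiasedness forces
  -- `A j` to tend to the identity entrywise, and the covariance passes to the limit as well.
  have hwν : ∀ j, crossGram (w j) ν = A j := fun j => by
    simp only [hw, crossGram_sum_left, crossGram_act_left, hνn _ (hs j _), hA]
  have hA1 : ∀ θ k, Tendsto (fun j => (A j *ᵥ θ) k) atTop (𝓝 (θ k)) := fun θ k => by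
    rw [← hmean θ k]
    refine ((tendsto_const_nhds (x := oneLp P)).inner (𝕜 := ℝ) (hlim' θ k)).congr fun j => ?_
    rw [hdec, (hwc j).inner_constLp_add]
  refine ⟨τ θ - constLp P θ, fun k => ?_, by simpa using hτ θ, ?_⟩
  · rw [Pi.sub_apply, inner_sub_right, hmean, constLp, real_inner_smul_right, inner_oneLp_oneLp,
      mul_one, sub_self]
  · ext k k'
    have h1 : Tendsto (fun j => ⟪(∑ i, act (C j i) (obsLp F n θ (s j i))) k, ν k'⟫) atTop
        (𝓝 ⟪τ θ k, ν k'⟫) := (hlim' θ k).inner tendsto_const_nhds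
    have h2 : ∀ c : Fin p → ℝ, ⟪constLp P c k, ν k'⟫ = 0 := fun c => by
      rw [constLp, real_inner_smul_left, hν, mul_zero]
    have h3 : ∀ j, ⟪(∑ i, act (C j i) (obsLp F n θ (s j i))) k, ν k'⟫ =
        (A j *ᵥ Pi.single k' 1) k := fun j => by
      rw [hdec, Pi.add_apply, inner_add_left, h2, zero_add, Matrix.mulVec_single_one,
        Matrix.col_apply, ← hwν j]
      rfl
    simp only [h3] at h1
    rw [crossGram, Matrix.of_apply, Pi.sub_apply, inner_sub_left, h2, sub_zero,
      tendsto_nhds_unique h1 (hA1 (Pi.single k' 1) k), Matrix.one_apply, Pi.single_apply]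

variable {m : ℕ} {t : Fin (m + 1) → ℝ} {Φ : Fin m → Matrix (Fin p) (Fin 2) ℝ}

lemma isRep_thetaDiscrete (hn : RepresentsNoise S ε n) (θ : Fin p → ℝ) :
    IsRep P (thetaDiscrete F S a b ε t Φ θ)
      (constLp P (((matM F S a b)⁻¹ * (designMat F S t Φ + (1 / a) • (F a * S⁻¹ * (F a)ᵀ))) *ᵥ θ) +
        act (matM F S a b)⁻¹ (discreteNoise F S a n t Φ)) := by
  have e : act (matM F S a b)⁻¹ ((∑ i : Fin m, act (Φ i * S⁻¹)
        (obsLp F n θ (t i.succ) - obsLp F n θ (t i.castSucc))) +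
          act ((1 / a) • (F a * S⁻¹)) (obsLp F n θ a)) =
      constLp P (((matM F S a b)⁻¹ * (designMat F S t Φ + (1 / a) • (F a * S⁻¹ * (F a)ᵀ))) *ᵥ θ) +
        act (matM F S a b)⁻¹ (discreteNoise F S a n t Φ) := by
    simp only [obsLp, add_sub_add_comm, constLp_sub, act_add, act_constLp, Finset.sum_add_distrib,
      constLp_sum, discreteNoise]
    rw [add_add_add_comm, constLp_add, ← Matrix.mulVec_add, ← Matrix.mulVec_mulVec,
      Matrix.add_mulVec, designMat, Matrix.sum_mulVec]
    simp only [← Matrix.mulVec_mulVec, Matrix.smul_mulVec, Matrix.transpose_sub, Matrix.sub_mulVec]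
  rw [← e]
  exact ((IsRep.sum fun i => ((hn.isRep_obs θ (t i.succ)).sub
    (hn.isRep_obs θ (t i.castSucc))).mulVec (Φ i * S⁻¹)).add
      ((hn.isRep_obs θ a).mulVec ((1 / a) • (F a * S⁻¹)))).mulVec (matM F S a b)⁻¹

lemma isCentered_discreteNoise (hc : ∀ t, IsCentered (n t)) :
    IsCentered (act (matM F S a b)⁻¹ (discreteNoise F S a n t Φ)) :=
  ((IsCentered.sum fun _ => ((hc _).sub (hc _)).act _).add ((hc a).act _)).act _

lemma isUnbiased_thetaDiscrete_iff (hn : RepresentsNoise S ε n) (hc : ∀ t, IsCentered (n t))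
    (hM : IsUnit (matM F S a b)) :
    IsUnbiased (thetaDiscrete F S a b ε t Φ) P ↔ designMat F S t Φ = matM₀ F S a b := by
  have hd : IsUnit (matM F S a b).det := (Matrix.isUnit_iff_isUnit_det _).1 hM
  rw [isUnbiased_iff (isRep_thetaDiscrete hn) (isCentered_discreteNoise hc)]
  constructor
  · intro h
    have h2 : designMat F S t Φ + (1 / a) • (F a * S⁻¹ * (F a)ᵀ) = matM F S a b := by
      rw [← Matrix.mul_nonsing_inv_cancel_left _ (designMat F S t Φ + _) hd, h, Matrix.mul_one]
    exact add_right_cancel h2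
  · intro h
    rw [h, ← matM, Matrix.nonsing_inv_mul _ hd]


end Model

/-! ### Weights proportional to the difference quotients of `F`. -/

section OptimalWeights

variable {p m : ℕ} {F : ℝ → Matrix (Fin p) (Fin 2) ℝ} {S : Matrix (Fin 2) (Fin 2) ℝ}
  {t : Fin (m + 1) → ℝ} {A : Matrix (Fin p) (Fin p) ℝ}
  {Φ Φs : Fin m → Matrix (Fin p) (Fin 2) ℝ}

lemma designMat_of_proportional (hΦ : ∀ i, Φs i =
    A * ((1 / (t i.succ - t i.castSucc)) • (F (t i.succ) - F (t i.castSucc)))) :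
    designMat F S t Φs = A * matB F S t := by
  simp only [designMat, matB, hΦ, Finset.mul_sum, Matrix.mul_smul, Matrix.smul_mul,
    Matrix.mul_assoc]

/-- The reason for the form of the optimal weights: `Δtᵢ` cancels, leaving a quantity that sees `Φ`
only through the matrix fixed by unbiasedness. -/
lemma weightMat_of_proportional (ht : StrictMono t) (hΦ : ∀ i, Φs i =
    A * ((1 / (t i.succ - t i.castSucc)) • (F (t i.succ) - F (t i.castSucc)))) :
    weightMat S t Φ Φs = designMat F S t Φ * Aᵀ := by
  rw [weightMat, designMat, Finset.sum_mul]
  refine Finset.sum_congr rfl fun i _ => ?_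
  have hne : t i.succ - t i.castSucc ≠ 0 := (sub_pos.2 (ht Fin.castSucc_lt_succ)).ne'
  rw [hΦ, Matrix.transpose_mul, Matrix.transpose_smul, Matrix.smul_mul, Matrix.mul_smul, smul_smul,
    mul_one_div_cancel hne, one_smul, Matrix.mul_assoc (Φ i * S⁻¹)]

lemma transpose_mul_mul_transpose_of_symm {C : Matrix (Fin 2) (Fin 2) ℝ} (hC : Cᵀ = C)
    (G : Matrix (Fin p) (Fin 2) ℝ) : (G * C * Gᵀ)ᵀ = G * C * Gᵀ := by
  rw [Matrix.transpose_mul, Matrix.transpose_mul, Matrix.transpose_transpose, hC, Matrix.mul_assoc]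

lemma transpose_matB (hST : Sᵀ = S) : (matB F S t)ᵀ = matB F S t := by
  have hSi : (S⁻¹)ᵀ = S⁻¹ := by rw [Matrix.transpose_nonsing_inv, hST]
  simp only [matB, Matrix.transpose_sum, Matrix.transpose_smul,
    transpose_mul_mul_transpose_of_symm hSi]

lemma transpose_matM₀ (hST : Sᵀ = S) (a b : ℝ) : (matM₀ F S a b)ᵀ = matM₀ F S a b := by
  have hSi : (S⁻¹)ᵀ = S⁻¹ := by rw [Matrix.transpose_nonsing_inv, hST]
  ext k l
  simp only [Matrix.transpose_apply, matM₀, Matrix.of_apply]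
  congr 1
  ext u
  exact congrFun (congrFun (transpose_mul_mul_transpose_of_symm hSi (dotF F a b u)) k) l

lemma transpose_matM (hST : Sᵀ = S) (a b : ℝ) : (matM F S a b)ᵀ = matM F S a b := by
  have hSi : (S⁻¹)ᵀ = S⁻¹ := by rw [Matrix.transpose_nonsing_inv, hST]
  rw [matM, Matrix.transpose_add, transpose_matM₀ hST, Matrix.transpose_smul,
    transpose_mul_mul_transpose_of_symm hSi]

end OptimalWeights

end CurveDesign

end

open CurveDesign

/-! ### The theorem: two applications of Pythagoras. -/

theorem mainTheorem3 {Ω : Type*} [MeasurableSpace Ω] (P : Measure Ω) [IsProbabilityMeasure P]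
    (ε : Fin 2 → ℝ≥0 → Ω → ℝ) (hε : CurveDesign.IsBrownianPair ε P)
    (a b : ℝ) (ha : 0 < a) (hab : a < b)
    (σ₁ σ₂ ρ : ℝ) (hσ₁ : 0 < σ₁) (hσ₂ : 0 < σ₂) (hρ : ρ ∈ Ioo (-1 : ℝ) 1)
    (S : Matrix (Fin 2) (Fin 2) ℝ) (hS : S = CurveDesign.sigmaMat σ₁ σ₂ ρ)
    (p : ℕ) (F : ℝ → Matrix (Fin p) (Fin 2) ℝ) (hF : CurveDesign.IsC1 F a b)
    (hM : IsUnit (CurveDesign.matM F S a b))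
    (m : ℕ) (t : Fin (m + 1) → ℝ) (ht : StrictMono t)
    (hta : t 0 = a) (htb : t (Fin.last m) = b)
    (hB : IsUnit (CurveDesign.matB F S t))
    (Φstar : Fin m → Matrix (Fin p) (Fin 2) ℝ)
    (hΦstar : ∀ i : Fin m, Φstar i =
      CurveDesign.matM₀ F S a b * (CurveDesign.matB F S t)⁻¹ *
        ((1 / (t i.succ - t i.castSucc)) • (F (t i.succ) - F (t i.castSucc)))) :
    CurveDesign.IsBLUE F S a b ε P (CurveDesign.thetaBLUE F S a b ε P) ∧
    CurveDesign.IsUnbiased (CurveDesign.thetaDiscrete F S a b ε t Φstar) P ∧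
    (∀ Φ : Fin m → Matrix (Fin p) (Fin 2) ℝ,
      CurveDesign.IsUnbiased (CurveDesign.thetaDiscrete F S a b ε t Φ) P →
      ∀ θ : Fin p → ℝ,
        (CurveDesign.mseMatrix (CurveDesign.thetaBLUE F S a b ε P θ)
            (CurveDesign.thetaDiscrete F S a b ε t Φ θ) P -
          CurveDesign.mseMatrix (CurveDesign.thetaBLUE F S a b ε P θ)
            (CurveDesign.thetaDiscrete F S a b ε t Φstar θ) P).PosSemidef) ∧
    (∀ θ : Fin p → ℝ,
      CurveDesign.covMatrix (CurveDesign.thetaDiscrete F S a b ε t Φstar θ) P =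
        (CurveDesign.matM F S a b)⁻¹ *
          (CurveDesign.matM₀ F S a b * (CurveDesign.matB F S t)⁻¹ * CurveDesign.matM₀ F S a b +
            (1 / a) • (F a * S⁻¹ * (F a)ᵀ)) *
          (CurveDesign.matM F S a b)⁻¹) := by
  subst hS
  have hpd := posDef_sigmaMat hσ₁ hσ₂ hρ
  set S := sigmaMat σ₁ σ₂ ρ
  have hS : IsUnit S := hpd.isUnit
  have hST : Sᵀ = S := by
    rw [← Matrix.conjTranspose_eq_transpose_of_trivial]
    exact hpd.isHermitian
  obtain ⟨n, hN, hc, hn⟩ := hε.exists_noise hpd.posSemidef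
  choose ξ hξ using fun (k : Fin p) (l : Fin 2) =>
    hN.exists_integral ha.le hab.le (hF.continuousOn_dotF_mul hab S⁻¹ k l) l
  have hξ' : IsScoreIntegral F S a b n ξ := hξ
  set ν := score F S a n ξ with hν
  have hνc : IsCentered ν := hξ'.isCentered_score hab.le hc
  have hνn : ∀ u ∈ Icc a b, crossGram (n u) ν = (F u)ᵀ := fun u hu => by
    rw [← crossGram_transpose, hN.crossGram_score hS hST hF ha hab hξ' hu]
  have hνν : crossGram ν ν = matM F S a b := hN.crossGram_score_score hS hST hF ha hab hξ'
  have hd : IsUnit (matM F S a b).det := (Matrix.isUnit_iff_isUnit_det _).1 hM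
  have hBd : IsUnit (matB F S t).det := (Matrix.isUnit_iff_isUnit_det _).1 hB
  set β := act (matM F S a b)⁻¹ ν with hβ
  have hβc : IsCentered β := hνc.act _
  have hrep : ∀ θ, IsRep P (thetaBLUE F S a b ε P θ) (constLp P θ + β) := fun θ => by
    rw [hβ, hν, ← blueLp_eq hF hab hM]
    exact isRep_thetaBLUE hn hξ' hF ha.le hab θ
  have hmin : ∀ u : Fin p → Lp ℝ 2 P, crossGram u ν = 1 →
      crossGram (u - β) (u - β) = crossGram u u - crossGram β β := fun u hu => by
    rw [hβ, ← hνν]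
    exact crossGram_sub_act_inv hu (hνν ▸ hM)
  have hdesign : designMat F S t Φstar = matM₀ F S a b := by
    rw [designMat_of_proportional hΦstar, Matrix.mul_assoc, Matrix.nonsing_inv_mul _ hBd,
      Matrix.mul_one]
  set D := fun Φ => discreteNoise F S a n t Φ with hD
  -- The value is the same for all unbiased `Φ`, including `Φstar`, so `D Φ - D Φstar` is orthogonal
  -- to `D Φstar`.
  have hcross : ∀ Φ, designMat F S t Φ = matM₀ F S a b → crossGram (D Φ) (D Φstar) =
      matM₀ F S a b * (matB F S t)⁻¹ * matM₀ F S a b + (1 / a) • (F a * S⁻¹ * (F a)ᵀ) := by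
    intro Φ hΦ
    rw [hD, hN.crossGram_discreteNoise hS hST ht hta ha, weightMat_of_proportional ht hΦstar, hΦ,
      Matrix.transpose_mul, Matrix.transpose_nonsing_inv, transpose_matB hST, transpose_matM₀ hST,
      ← Matrix.mul_assoc]
  have hDν : ∀ Φ, designMat F S t Φ = matM₀ F S a b →
      crossGram (act (matM F S a b)⁻¹ (D Φ)) ν = 1 := fun Φ hΦ => by
    rw [crossGram_act_left, hD, crossGram_discreteNoise_left ht hta htb hab.le hνn, hΦ, ← matM,
      Matrix.nonsing_inv_mul _ hd]
  have hrepD : ∀ Φ, designMat F S t Φ = matM₀ F S a b → ∀ θ,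
      IsRep P (thetaDiscrete F S a b ε t Φ θ) (constLp P θ + act (matM F S a b)⁻¹ (D Φ)) := by
    intro Φ hΦ θ
    have h := isRep_thetaDiscrete (F := F) (a := a) (b := b) (t := t) (Φ := Φ) hn θ
    rwa [hΦ, ← matM, Matrix.nonsing_inv_mul _ hd, Matrix.one_mulVec] at h
  have hmse : ∀ Φ, designMat F S t Φ = matM₀ F S a b → ∀ θ,
      mseMatrix (thetaBLUE F S a b ε P θ) (thetaDiscrete F S a b ε t Φ θ) P =
        crossGram (act (matM F S a b)⁻¹ (D Φ)) (act (matM F S a b)⁻¹ (D Φ)) - crossGram β β := by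
    intro Φ hΦ θ
    rw [(hrep θ).mseMatrix_eq (hrepD Φ hΦ θ), add_sub_add_left_eq_sub, crossGram_sub_comm,
      hmin _ (hDν Φ hΦ)]
  refine ⟨⟨isLinearEstimator_thetaBLUE hn hξ' hF ha.le hab, ?_, fun T hT hTu θ => ?_⟩,
    (isUnbiased_thetaDiscrete_iff hn hc hM).2 hdesign, fun Φ hΦ θ => ?_, fun θ => ?_⟩
  · exact (isUnbiased_iff (Q := 1) (fun θ => by rw [Matrix.one_mulVec]; exact hrep θ) hβc).2 rfl
  · obtain ⟨u, huc, hu, huν⟩ := hT.exists_isRep hn hc hνc hνn hTu θ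
    rw [hu.covMatrix_eq huc, (hrep θ).covMatrix_eq hβc, ← hmin u huν]
    exact posSemidef_crossGram _
  · rw [isUnbiased_thetaDiscrete_iff hn hc hM] at hΦ
    -- The covariance of `β` cancels, and the remaining difference is the Gram matrix of the
    -- difference of the two discrete errors.
    rw [hmse Φ hΦ, hmse Φstar hdesign, sub_sub_sub_cancel_right, ← crossGram_sub_sub]
    · exact posSemidef_crossGram _
    · simp only [crossGram_act_left, crossGram_act_right, hcross Φ hΦ, hcross Φstar hdesign]
  · rw [(hrepD Φstar hdesign θ).covMatrix_eq (isCentered_discreteNoise hc), crossGram_act_left,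
      crossGram_act_right, hcross Φstar hdesign, Matrix.transpose_nonsing_inv, transpose_matM hST,
      ← Matrix.mul_assoc]
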